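/- Fix $T>0$ and a compact set $\mathcal S\subset\mathbb R^3$ (possibly empty), and put $\mathcal S^c=\mathbb R^3\setminus\mathcal S$. Here $\nabla$ and $\nabla\times$ act on the space variable. Let $A\in C^1(\mathbb R\times\mathbb R^3;\mathbb R^3)$ be $T$-periodic in $t$, with $\partial_tA\not\equiv0$ and $\lim_{|x|\to\infty}\big(|\partial_tA(t,x)|+|\nabla A(t,x)|\big)=0$ uniformly in $t$. Let $\Phi:\mathbb R\times\mathcal S^c\to\mathbb R$ be bounded from above, $T$-periodic and continuous in $t$, with $\Phi(t,\cdot)\in C^1(\mathcal S^c)$ for every $t$, with $\nabla\Phi$ continuous on $\mathbb R\times\mathcal S^c$, and with $\lim_{|x|\to\infty}|\nabla\Phi(t,x)|=0$ uniformly in $t$. If $\mathcal S\ne\emptyset$, assume moreover that for every $x_0\in\partial\mathcal S$ and $t_0\in[0,T]$ there are $\varepsilon,r>0$ such that $$-\Phi(t,x)\ge\frac{r}{|x-x_0|}\quad\text{for all }(t,x)\in\mathbb R\times\mathcal S^c\text{ with }|x-x_0|<\varepsilon,\ |t-t_0|<\varepsilon .$$ Assume that $\partial_tA+\nabla\Phi\not\equiv0$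 on $\mathbb R\times\mathcal S^c$, and that the function $\varphi(x)=\int_0^T\Phi(t,x)\,dt$ on $\mathcal S^c$ is normalized by $\sup_{\mathcal S^c}\varphi=0$. Put $\tilde A(t,x)=A(t,x)-\frac1T\int_0^TA(s,x)\,ds$ and $\|\tilde A(\cdot,x)\|_2=\big(\int_0^T|\tilde A(t,x)|^2dt\big)^{1/2}$. Suppose that there is a sequence $\{b_n\}\subset\mathbb R^3$ with $|b_n|\to\infty$ such that $\partial_tA(\cdot,b_n)\not\equiv0$ for all $n$, $$\lim_{n\to\infty}\varphi(b_n)\,\|\tilde A(\cdot,b_n)\|_2^{-2}=0,$$ $$\lim_{n\to\infty}\max\{|\nabla\Phi(t,y)|:\ t\in[0,T],\ |y|\ge|b_n|-T\}\,\|\tilde A(\cdot,b_n)\|_2^{-1}=0$$ (the expressions in both limits are well defined for all large $n$). Consider the Lorentz force equation $$\frac{d}{dt}\left(\frac{\dot q}{\sqrt{1-|\dot q|^2}}\right)=E(t,q)+\dot q\times B(t,q),\qquad E=-\partial_tA-\nabla\Phi,\quad B=\nabla\times A, \qquad (\ast)$$ a $T$-periodic solution of which is a $T$-periodic function $q\in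 C^2(\mathbb R;\mathcal S^c)$ with $\|\dot q\|_\infty<1$ that satisfies $(\ast)$ at every time $t$. Then $(\ast)$ has at least one non-constant $T$-periodic solution. Moreover, if $\mathcal S=\emptyset$, there is $\rho\in(0,1)$ (depending only on $T$, $A$ and $\Phi$) such that $\|\dot q\|_\infty<\rho$ for every $T$-periodic solution $q$ of $(\ast)$. -/

import Mathlib

open Set Filter Topology MeasureTheory
open scoped ENNReal Matrix

namespace LorentzForce

/-- Physical space with the Euclidean norm. -/
abbrev E3 := EuclideanSpace ℝ (Fin 3)

/-- The cross product of two vectors of Euclidean space. -/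
noncomputable def cross (v w : E3) : E3 :=
  WithLp.toLp 2 ((WithLp.ofLp v) ⨯₃ (WithLp.ofLp w))

/-- `partialD F x i j` is the partial derivative at `x` of the `j`-th component of `F`
in the direction of the `i`-th coordinate. -/
noncomputable def partialD (F : E3 → E3) (x : E3) (i j : Fin 3) : ℝ :=
  fderiv ℝ F x (EuclideanSpace.single i 1) j

/-- The rotational of a vector field. -/
noncomputable def curl (F : E3 → E3) (x : E3) : E3 :=
  !₂[partialD F x 1 2 - partialD F x 2 1,
     partialD F x 2 0 - partialD F x 0 2,
     partialD F x 0 1 - partialD F x 1 0]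

/-- The time derivative of the vector potential, at fixed `x`. -/
noncomputable def timeDeriv (A : ℝ → E3 → E3) (t : ℝ) (x : E3) : E3 :=
  deriv (fun s => A s x) t

/-- The electric field `E = -∂ₜA - ∇Φ`. -/
noncomputable def electric (A : ℝ → E3 → E3) (Φ : ℝ → E3 → ℝ) (t : ℝ) (x : E3) : E3 :=
  -timeDeriv A t x - gradient (Φ t) x

/-- The magnetic field `B = ∇ × A`. -/
noncomputable def magnetic (A : ℝ → E3 → E3) (t : ℝ) (x : E3) : E3 :=
  curl (A t) x

/-- `f(t, x) → 0` as `|x| → ∞`, uniformly in `t`. -/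
def DecaysUniformly (f : ℝ → E3 → ℝ) : Prop :=
  ∀ ε > 0, ∃ R : ℝ, ∀ (t : ℝ) (x : E3), R ≤ ‖x‖ → |f t x| < ε

/-- The class of vector potentials: `C¹` on `ℝ⁴`, `T`-periodic in time, non-autonomous, and with
first derivatives decaying at infinity uniformly in time. -/
structure IsVectorPotential (T : ℝ) (A : ℝ → E3 → E3) : Prop where
  contDiff : ContDiff ℝ 1 (fun p : ℝ × E3 => A p.1 p.2)
  periodic : ∀ t x, A (t + T) x = A t x
  nonautonomous : ∃ t x, timeDeriv A t x ≠ 0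
  decay : DecaysUniformly (fun t x => ‖timeDeriv A t x‖ + ‖fderiv ℝ (A t) x‖)

/-- The class of scalar potentials with singular set `S`. A potential is a function on
`ℝ × Sᶜ`; the values of `Φ t x` for `x ∈ S` are irrelevant. -/
structure IsScalarPotential (T : ℝ) (S : Set E3) (Φ : ℝ → E3 → ℝ) : Prop where
  bddAbove : ∃ C : ℝ, ∀ t, ∀ x ∉ S, Φ t x ≤ C
  periodic : ∀ t, ∀ x ∉ S, Φ (t + T) x = Φ t x
  continuous_time : ∀ x ∉ S, Continuous (fun t => Φ t x)
  contDiffOn : ∀ t, ContDiffOn ℝ 1 (Φ t) Sᶜ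
  continuousOn_gradient :
    ContinuousOn (fun p : ℝ × E3 => gradient (Φ p.1) p.2) (univ ×ˢ Sᶜ)
  decay : DecaysUniformly (fun t x => ‖gradient (Φ t) x‖)
  coulomb : ∀ x₀ ∈ frontier S, ∀ t₀ ∈ Icc 0 T, ∃ ε > 0, ∃ r > 0, ∀ t, ∀ x ∉ S,
    ‖x - x₀‖ < ε → |t - t₀| < ε → r / ‖x - x₀‖ ≤ -Φ t x

/-- Admissible pairs of potentials: the electric field does not vanish identically. -/
structure IsAdmissible (T : ℝ) (S : Set E3) (A : ℝ → E3 → E3) (Φ : ℝ → E3 → ℝ) : Prop where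
  vector : IsVectorPotential T A
  scalar : IsScalarPotential T S Φ
  electric_ne_zero : ∃ t, ∃ x ∉ S, timeDeriv A t x + gradient (Φ t) x ≠ 0

/-- The integral `φ(x)` of the scalar potential over one period. -/
noncomputable def phiMean (T : ℝ) (Φ : ℝ → E3 → ℝ) (x : E3) : ℝ :=
  ∫ t in (0 : ℝ)..T, Φ t x

/-- The oscillation `Ã` of the vector potential about its time average. -/
noncomputable def oscillation (T : ℝ) (A : ℝ → E3 → E3) (t : ℝ) (x : E3) : E3 :=
  A t x - (1 / T) • ∫ s in (0 : ℝ)..T, A s x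

/-- The `L²(0,T)` norm of `Ã(·, x)`. -/
noncomputable def oscL2 (T : ℝ) (A : ℝ → E3 → E3) (x : E3) : ℝ :=
  Real.sqrt (∫ t in (0 : ℝ)..T, ‖oscillation T A t x‖ ^ 2)

/-- `max {|∇Φ(t, y)| : t ∈ [0, T], |y| ≥ R}`, over non-singular points `y`. For `Φ` in the class of
scalar potentials and all large `R` the set is nonempty and bounded, and the supremum is a
maximum. -/
noncomputable def farGradient (T : ℝ) (S : Set E3) (Φ : ℝ → E3 → ℝ) (R : ℝ) : ℝ :=
  sSup {g : ℝ | ∃ t ∈ Icc 0 T, ∃ y ∉ S, R ≤ ‖y‖ ∧ g = ‖gradient (Φ t) y‖}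

/-- The uniform norm of a function of time, with values in `[0, ∞]`. -/
noncomputable def supNorm (v : ℝ → E3) : ℝ≥0∞ := ⨆ t, ‖v t‖ₑ

/-- `q` is a `T`-periodic solution, of class `C²` and with values in `Sᶜ`, of the Lorentz force
equation `d/dt (q̇ / √(1 - |q̇|²)) = E(t, q) + q̇ × B(t, q)`, with `‖q̇‖_∞ < 1`. -/
structure IsPeriodicSolution (T : ℝ) (S : Set E3) (A : ℝ → E3 → E3) (Φ : ℝ → E3 → ℝ)
    (q : ℝ → E3) : Prop where
  contDiff : ContDiff ℝ 2 q
  notMem : ∀ t, q t ∉ S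
  periodic : ∀ t, q (t + T) = q t
  speed_lt : supNorm (deriv q) < 1
  equation : ∀ t, HasDerivAt (fun s => (1 / Real.sqrt (1 - ‖deriv q s‖ ^ 2)) • deriv q s)
    (electric A Φ t (q t) + cross (deriv q t) (magnetic A t (q t))) t

end LorentzForce

/-! The equation is the Euler–Lagrange equation of the action with density `1 - √(1 - |v|²) + ⟨v, A⟩
- Φ`, and a solution is found by minimising the action over closed curves of speed below one.

A constant loop at `x` has action `-φ(x) ≥ 0`, so a minimiser at a negative level cannot be
constant. Such a level exists: far out, the loop through `b n` with velocity `-Ã(·, b n)` gains a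
fixed multiple of `‖Ã‖₂²` from the magnetic coupling, and the hypotheses on `b` make every other
contribution small against that gain (`IsAdmissible.exists_action_neg`). Negative levels are compact
in space: distant loops have action close to or above zero, and the Coulomb bound gives nonnegative
action near the singular set, since a curve of speed at most one that comes close picks up a
logarithmically large integral of `-Φ` (`IsAdmissible.exists_compact_confinement`).

The speed constraint makes the functional nonsmooth, so the minimum is taken over loops in a compact
set `N` with speed at most `k < 1` and `M`-Lipschitz velocity, where Arzelà–Ascoli applies. The work
is to show that these artificial constraints are harmless. Leaving `N` is impossible for a
competitor below the level of the minimiser. Convexity of the kinetic term yields a variational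
inequality, which after integration by parts says that the velocity `v` does at least as well as any
admissible competitor in a convex problem with linear term `W`. The unconstrained solution of that
problem is `relVelocity (l - W t)`, with `l` fixed by mean zero. Its momentum is bounded a priori by
the oscillation of `W`, so for `k` and `M` chosen in advance it is an admissible competitor, and the
quadratic remainder in the Fenchel inequality forces `v` to equal it
(`IsAdmissible.isPeriodicSolution_of_minimizer`). This identity is the integrated Lorentz equation.

If there is no singular set, forces are bounded everywhere, and the same momentum estimate applied
to an arbitrary solution gives the uniform `ρ`. -/

namespace LorentzForce

/-! ### Convex duality between velocity and relativistic momentum. -/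

section RelativisticVelocity

variable {V : Type*} [NormedAddCommGroup V] [InnerProductSpace ℝ V]

/-- The velocity of a particle of unit mass with relativistic momentum `p`. -/
noncomputable def relVelocity (p : V) : V := (1 / √(1 + ‖p‖ ^ 2)) • p

theorem sqrt_one_add_sq_pos (x : ℝ) : 0 < √(1 + x ^ 2) := Real.sqrt_pos.2 (by positivity)

theorem one_le_sqrt_one_add_sq (x : ℝ) : 1 ≤ √(1 + x ^ 2) :=
  Real.one_le_sqrt.2 (by nlinarith [sq_nonneg x])

theorem norm_relVelocity (p : V) : ‖relVelocity p‖ = ‖p‖ / √(1 + ‖p‖ ^ 2) := by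
  rw [relVelocity, norm_smul, Real.norm_of_nonneg (by positivity)]
  ring

theorem one_sub_norm_relVelocity_sq (p : V) :
    1 - ‖relVelocity p‖ ^ 2 = (1 / √(1 + ‖p‖ ^ 2)) ^ 2 := by
  have h := sqrt_one_add_sq_pos ‖p‖
  have h2 : √(1 + ‖p‖ ^ 2) ^ 2 = 1 + ‖p‖ ^ 2 := Real.sq_sqrt (by positivity)
  rw [norm_relVelocity, div_pow, div_pow, h2]
  field_simp
  ring

theorem sqrt_one_sub_norm_relVelocity_sq (p : V) :
    √(1 - ‖relVelocity p‖ ^ 2) = 1 / √(1 + ‖p‖ ^ 2) := by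
  rw [one_sub_norm_relVelocity_sq, Real.sqrt_sq (by positivity)]

theorem momentum_relVelocity (p : V) :
    (1 / √(1 - ‖relVelocity p‖ ^ 2)) • relVelocity p = p := by
  rw [sqrt_one_sub_norm_relVelocity_sq, relVelocity, smul_smul]
  have h := sqrt_one_add_sq_pos ‖p‖
  rw [one_div_one_div, mul_one_div_cancel h.ne', one_smul]

theorem relVelocity_momentum {v : V} (hv : ‖v‖ < 1) :
    relVelocity ((1 / √(1 - ‖v‖ ^ 2)) • v) = v := by
  have h0 : 0 < 1 - ‖v‖ ^ 2 := by nlinarith [norm_nonneg v]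
  have hs := Real.sqrt_pos.2 h0
  have h2 : √(1 - ‖v‖ ^ 2) ^ 2 = 1 - ‖v‖ ^ 2 := Real.sq_sqrt h0.le
  have h3 : 1 + ‖(1 / √(1 - ‖v‖ ^ 2)) • v‖ ^ 2 = (1 / √(1 - ‖v‖ ^ 2)) ^ 2 := by
    rw [norm_smul, Real.norm_of_nonneg (by positivity), mul_pow, div_pow, h2]
    field_simp
    ring
  rw [relVelocity, h3, Real.sqrt_sq (by positivity), one_div_one_div, smul_smul,
    mul_one_div_cancel hs.ne', one_smul]

theorem relVelocity_bound_lt_one (Y : ℝ) : Y / √(1 + Y ^ 2) < 1 := by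
  rw [div_lt_one (sqrt_one_add_sq_pos Y)]
  exact Real.lt_sqrt_of_sq_lt (by linarith)

theorem norm_relVelocity_lt_one (p : V) : ‖relVelocity p‖ < 1 := by
  rw [norm_relVelocity]
  exact relVelocity_bound_lt_one _

theorem norm_relVelocity_le {p : V} {Y : ℝ} (h : ‖p‖ ≤ Y) :
    ‖relVelocity p‖ ≤ Y / √(1 + Y ^ 2) := by
  have hY : 0 ≤ Y := (norm_nonneg p).trans h
  rw [norm_relVelocity, div_le_div_iff₀ (sqrt_one_add_sq_pos _) (sqrt_one_add_sq_pos _)]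
  refine le_of_pow_le_pow_left₀ two_ne_zero (by positivity) ?_
  rw [mul_pow, mul_pow, Real.sq_sqrt (by positivity), Real.sq_sqrt (by positivity)]
  nlinarith [mul_self_le_mul_self (norm_nonneg p) h]

theorem contDiff_relVelocity {n : WithTop ℕ∞} : ContDiff ℝ n (relVelocity : V → V) := by
  unfold relVelocity
  refine ContDiff.smul (contDiff_const.div (ContDiff.sqrt ?_ ?_) ?_) contDiff_id
  · exact contDiff_const.add (contDiff_norm_sq ℝ)
  · intro x; positivity
  · intro x; exact (sqrt_one_add_sq_pos _).ne'

theorem continuous_relVelocity : Continuous (relVelocity : V → V) :=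
  (contDiff_relVelocity (n := 0)).continuous

/-- The Fenchel inequality for the relativistic kinetic energy, with a quadratic remainder. -/
theorem inner_add_sqrt_add_sq_le (p u : V) (hu : ‖u‖ ≤ 1) :
    inner ℝ p u + √(1 - ‖u‖ ^ 2) + ‖u - relVelocity p‖ ^ 2 / 2 ≤ √(1 + ‖p‖ ^ 2) := by
  have hN := sqrt_one_add_sq_pos ‖p‖
  have hN1 := one_le_sqrt_one_add_sq ‖p‖
  have hN2 : √(1 + ‖p‖ ^ 2) ^ 2 = 1 + ‖p‖ ^ 2 := Real.sq_sqrt (by positivity)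
  have ha2 : √(1 - ‖u‖ ^ 2) ^ 2 = 1 - ‖u‖ ^ 2 :=
    Real.sq_sqrt (by nlinarith [norm_nonneg u])
  have hc := real_inner_le_norm p u
  have hx : ‖u - relVelocity p‖ ^ 2 = ‖u‖ ^ 2 - 2 * (inner ℝ p u * (1 / √(1 + ‖p‖ ^ 2)))
      + ‖p‖ ^ 2 * (1 / √(1 + ‖p‖ ^ 2)) ^ 2 := by
    rw [norm_sub_sq_real, norm_relVelocity, relVelocity, inner_smul_right, real_inner_comm]
    ring
  rw [hx]
  generalize √(1 + ‖p‖ ^ 2) = N at *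
  generalize √(1 - ‖u‖ ^ 2) = a at *
  generalize inner ℝ p u = c at *
  generalize ‖p‖ = y at *
  have hu2 : ‖u‖ ^ 2 = 1 - a ^ 2 := by linarith
  have hm : 0 < 1 / N := by positivity
  have hmN : N * (1 / N) = 1 := mul_one_div_cancel hN.ne'
  have hm1 : 1 / N ≤ 1 := by rw [div_le_one hN]; exact hN1
  generalize 1 / N = m at *
  have hy2 : y ^ 2 * m ^ 2 = 1 - m ^ 2 := by
    have h1 : y ^ 2 = N ^ 2 - 1 := by linarith
    have h2 : (N * m) ^ 2 = 1 := by rw [hmN]; norm_num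
    rw [h1]; linarith [mul_pow N m 2]
  -- Cauchy–Schwarz, then `2 y m ‖u‖ ≤ y² m² + ‖u‖²`. Multiplying the claim by `m = 1 / N` then
  -- reduces it to `(a - m)² ≥ 0`.
  have hC : c * m ≤ 1 - (a ^ 2 + m ^ 2) / 2 := by
    have h1 : c * m ≤ y * ‖u‖ * m := mul_le_mul_of_nonneg_right hc hm.le
    nlinarith [sq_nonneg (y * m - ‖u‖)]
  have h3 : c * m * (1 - m) ≤ (1 - (a ^ 2 + m ^ 2) / 2) * (1 - m) :=
    mul_le_mul_of_nonneg_right hC (by linarith)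
  have h4 : (c + a + (‖u‖ ^ 2 - 2 * (c * m) + y ^ 2 * m ^ 2) / 2) * m ≤ N * m := by
    rw [hmN, hu2, hy2]
    nlinarith [sq_nonneg (a - m)]
  exact le_of_mul_le_mul_right h4 hm

theorem inner_relVelocity_add_sqrt (p : V) :
    inner ℝ p (relVelocity p) + √(1 - ‖relVelocity p‖ ^ 2) = √(1 + ‖p‖ ^ 2) := by
  rw [sqrt_one_sub_norm_relVelocity_sq, relVelocity, inner_smul_right, real_inner_self_eq_norm_sq]
  have hN := sqrt_one_add_sq_pos ‖p‖
  have hN2 : √(1 + ‖p‖ ^ 2) ^ 2 = 1 + ‖p‖ ^ 2 := Real.sq_sqrt (by positivity)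
  field_simp
  linarith

/-- Adding the Fenchel inequalities at `p` and `r`, the two quadratic remainders give `‖Δv‖² ≤ ⟨p -
r, Δv⟩`. This transfers Lipschitz bounds from momentum to velocity. -/
theorem norm_relVelocity_sub_le (p r : V) : ‖relVelocity p - relVelocity r‖ ≤ ‖p - r‖ := by
  have h1 := inner_add_sqrt_add_sq_le p (relVelocity r) (norm_relVelocity_lt_one r).le
  have h2 := inner_add_sqrt_add_sq_le r (relVelocity p) (norm_relVelocity_lt_one p).le
  have h3 := inner_relVelocity_add_sqrt p
  have h4 := inner_relVelocity_add_sqrt r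
  rw [norm_sub_rev] at h1
  have h5 : ‖relVelocity p - relVelocity r‖ ^ 2 ≤ inner ℝ (p - r) (relVelocity p - relVelocity r) := by
    simp only [inner_sub_left, inner_sub_right]
    linarith
  have h6 := real_inner_le_norm (p - r) (relVelocity p - relVelocity r)
  by_contra! h
  have h7 := norm_nonneg (p - r)
  nlinarith

/-- The tangent line bound `√(N² + δ) ≤ N + δ / (2N)` with `N ≥ 1`. It is the second-order estimate
behind the descent step in `exists_integral_relVelocity_eq_zero`. -/
theorem sqrt_one_add_norm_sq_add_le (p e : V) (s : ℝ) :
    √(1 + ‖p + s • e‖ ^ 2) ≤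
      √(1 + ‖p‖ ^ 2) + s * inner ℝ e (relVelocity p) + s ^ 2 * ‖e‖ ^ 2 / 2 := by
  have hN := sqrt_one_add_sq_pos ‖p‖
  have hN1 := one_le_sqrt_one_add_sq ‖p‖
  have hN2 : √(1 + ‖p‖ ^ 2) ^ 2 = 1 + ‖p‖ ^ 2 := Real.sq_sqrt (by positivity)
  have h1 : √(1 + ‖p + s • e‖ ^ 2) ≤
      √(1 + ‖p‖ ^ 2) + (2 * s * inner ℝ p e + s ^ 2 * ‖e‖ ^ 2) * (1 / (2 * √(1 + ‖p‖ ^ 2))) := by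
    have h2 : 1 + ‖p + s • e‖ ^ 2
        = √(1 + ‖p‖ ^ 2) ^ 2 + (2 * s * inner ℝ p e + s ^ 2 * ‖e‖ ^ 2) := by
      rw [hN2, norm_add_sq_real, norm_smul, inner_smul_right, mul_pow, Real.norm_eq_abs, sq_abs]
      ring
    have h0 : 0 ≤ √(1 + ‖p‖ ^ 2) ^ 2 + (2 * s * inner ℝ p e + s ^ 2 * ‖e‖ ^ 2) := by
      rw [← h2]; positivity
    rw [h2]
    generalize 2 * s * inner ℝ p e + s ^ 2 * ‖e‖ ^ 2 = δ at *
    generalize √(1 + ‖p‖ ^ 2) = N at *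
    apply Real.sqrt_le_iff.2 ⟨?_, ?_⟩
    · have : N + δ * (1 / (2 * N)) = (N ^ 2 + (N ^ 2 + δ)) * (1 / (2 * N)) := by field_simp; ring
      rw [this]; positivity
    · have : (N + δ * (1 / (2 * N))) ^ 2 = N ^ 2 + δ + (δ * (1 / (2 * N))) ^ 2 := by
        field_simp; ring
      rw [this]; nlinarith [sq_nonneg (δ * (1 / (2 * N)))]
  refine h1.trans ?_
  have h3 : inner ℝ e (relVelocity p) = inner ℝ p e * (1 / √(1 + ‖p‖ ^ 2)) := by
    rw [relVelocity, inner_smul_right, real_inner_comm]; ring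
  have h4 : (1 / (2 * √(1 + ‖p‖ ^ 2))) ≤ 1 / 2 := by
    apply one_div_le_one_div_of_le <;> linarith
  have h5 := mul_le_mul_of_nonneg_left h4 (show 0 ≤ s ^ 2 * ‖e‖ ^ 2 by positivity)
  rw [h3]
  have h6 : 2 * s * inner ℝ p e * (1 / (2 * √(1 + ‖p‖ ^ 2)))
      = s * (inner ℝ p e * (1 / √(1 + ‖p‖ ^ 2))) := by field_simp
  linarith

/-- Convexity of the relativistic kinetic energy. -/
theorem le_sqrt_one_sub_norm_sq_combination {v u : V} (hv : ‖v‖ < 1) (hu : ‖u‖ ≤ 1) {s : ℝ}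
    (h0 : 0 ≤ s) (h1 : s < 1) :
    (1 - s) * √(1 - ‖v‖ ^ 2) + s * √(1 - ‖u‖ ^ 2) ≤ √(1 - ‖v + s • (u - v)‖ ^ 2) := by
  have hw : v + s • (u - v) = (1 - s) • v + s • u := by module
  have hw1 : ‖v + s • (u - v)‖ < 1 := by
    rw [hw]
    refine (norm_add_le _ _).trans_lt ?_
    rw [norm_smul, norm_smul, Real.norm_of_nonneg h0, Real.norm_of_nonneg (by linarith)]
    nlinarith [norm_nonneg u, norm_nonneg v]
  -- The momentum `p` of the intermediate velocity supplies a supporting affine function: Fenchel is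
  -- an equality there and an inequality at `v` and `u`.
  obtain ⟨p, hp⟩ : ∃ p, relVelocity p = v + s • (u - v) := ⟨_, relVelocity_momentum hw1⟩
  have e := inner_relVelocity_add_sqrt p
  have ev := inner_add_sqrt_add_sq_le p v hv.le
  have eu := inner_add_sqrt_add_sq_le p u hu
  have ev' : inner ℝ p v + √(1 - ‖v‖ ^ 2) ≤ √(1 + ‖p‖ ^ 2) := by
    linarith [sq_nonneg ‖v - relVelocity p‖]
  have eu' : inner ℝ p u + √(1 - ‖u‖ ^ 2) ≤ √(1 + ‖p‖ ^ 2) := by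
    linarith [sq_nonneg ‖u - relVelocity p‖]
  rw [hp] at e
  have : inner ℝ p (v + s • (u - v)) = (1 - s) * inner ℝ p v + s * inner ℝ p u := by
    rw [hw, inner_add_right, inner_smul_right, inner_smul_right]
  nlinarith

theorem intervalIntegral_inner [CompleteSpace V] {f : ℝ → V} (hf : Continuous f) (a b : ℝ) (c : V) :
    ∫ t in a..b, inner ℝ c (f t) = inner ℝ c (∫ t in a..b, f t) :=
  (innerSL ℝ c).intervalIntegral_comp_comm (hf.intervalIntegrable a b)

/-- If the velocity has mean zero, then the momentum is controlled by its oscillation. -/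
theorem norm_le_of_integral_relVelocity_eq_zero [CompleteSpace V] {T D : ℝ} (hT : 0 < T)
    {p : ℝ → V} (hp : Continuous p) (hD : ∀ t ∈ Icc 0 T, ‖p t - p 0‖ ≤ D)
    (h0 : ∫ t in (0 : ℝ)..T, relVelocity (p t) = 0) : ‖p 0‖ ≤ D := by
  -- Were `‖p 0‖ > D`, every `p t` would lie in the open half-space `⟨p 0, ·⟩ > 0`, and so would
  -- every velocity, which mean zero forbids.
  by_contra! h
  have hpos : 0 < ∫ t in (0 : ℝ)..T, inner ℝ (p 0) (relVelocity (p t)) := by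
    apply intervalIntegral.intervalIntegral_pos_of_pos_on _ _ hT
    · exact Continuous.intervalIntegrable
        (continuous_const.inner (continuous_relVelocity.comp hp)) _ _
    · intro t ht
      rw [relVelocity, inner_smul_right]
      have h1 := hD t (Ioo_subset_Icc_self ht)
      have h2 : inner ℝ (p 0) (p t) = ‖p 0‖ ^ 2 + inner ℝ (p 0) (p t - p 0) := by
        rw [inner_sub_right, real_inner_self_eq_norm_sq]; ring
      have h3 := neg_le_of_abs_le (abs_real_inner_le_norm (p 0) (p t - p 0))
      have h4 : 0 < inner ℝ (p 0) (p t) := by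
        rw [h2]; nlinarith [norm_nonneg (p 0), norm_nonneg (p t - p 0)]
      exact mul_pos (one_div_pos.2 (sqrt_one_add_sq_pos _)) h4
  have hc : Continuous fun t => relVelocity (p t) := continuous_relVelocity.comp hp
  rw [intervalIntegral_inner hc, h0, inner_zero_right] at hpos
  exact hpos.false

/-- Every continuous force potential `W` can be translated by a constant momentum so that the
resulting velocity has mean zero. -/
theorem exists_integral_relVelocity_eq_zero [FiniteDimensional ℝ V] {T : ℝ} (hT : 0 < T)
    {W : ℝ → V} (hW : Continuous W) :
    ∃ l : V, ∫ t in (0 : ℝ)..T, relVelocity (l - W t) = 0 := by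
  have : ProperSpace V := FiniteDimensional.proper ℝ V
  have : CompleteSpace V := FiniteDimensional.complete ℝ V
  -- `H` is coercive and its gradient at `l` is the integral of `relVelocity (l - W t)`, so a
  -- minimum point is the required translate.
  set H : V → ℝ := fun l => ∫ t in (0 : ℝ)..T, √(1 + ‖l - W t‖ ^ 2) with hH
  have hcont : Continuous H := by
    apply intervalIntegral.continuous_parametric_intervalIntegral_of_continuous'
    fun_prop
  obtain ⟨C, hC⟩ := isCompact_Icc.exists_bound_of_continuousOn (s := Icc 0 T) hW.continuousOn
  have hlow : ∀ l, T * (‖l‖ - C) ≤ H l := by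
    intro l
    have : T * (‖l‖ - C) = ∫ t in (0 : ℝ)..T, (‖l‖ - C) := by simp [mul_sub]
    rw [this]
    apply intervalIntegral.integral_mono_on hT.le (by simp)
    · exact Continuous.intervalIntegrable (by fun_prop) _ _
    · intro t ht
      have h1 := hC t ht
      have h2 : ‖l‖ - ‖W t‖ ≤ ‖l - W t‖ := norm_sub_norm_le _ _
      have h3 : ‖l - W t‖ ≤ √(1 + ‖l - W t‖ ^ 2) := Real.le_sqrt_of_sq_le (by linarith)
      linarith
  have hco : Tendsto H (cocompact V) atTop := by
    apply tendsto_atTop_mono hlow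
    apply Tendsto.const_mul_atTop hT
    exact tendsto_atTop_add_const_right _ _ (tendsto_norm_cocompact_atTop)
  obtain ⟨l, hl⟩ := hcont.exists_forall_le hco
  refine ⟨l, ?_⟩
  have hPc : Continuous (fun t => relVelocity (l - W t)) :=
    continuous_relVelocity.comp (by fun_prop)
  set d := ∫ t in (0 : ℝ)..T, relVelocity (l - W t) with hd
  -- A gradient step of length `1 / T` lowers `H` by at least `‖d‖² / (2T)`, so minimality gives `d
  -- = 0` without differentiating `H`.
  have key : H (l + (-(1 / T)) • d) ≤ H l + (-(1 / T)) * ‖d‖ ^ 2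
      + T * ((1 / T) ^ 2 * ‖d‖ ^ 2 / 2) := by
    have e : H l + (-(1 / T)) * ‖d‖ ^ 2 + T * ((1 / T) ^ 2 * ‖d‖ ^ 2 / 2)
        = ∫ t in (0 : ℝ)..T, (√(1 + ‖l - W t‖ ^ 2)
          + (-(1 / T)) * inner ℝ d (relVelocity (l - W t)) + (-(1 / T)) ^ 2 * ‖d‖ ^ 2 / 2) := by
      rw [intervalIntegral.integral_add, intervalIntegral.integral_add,
        intervalIntegral.integral_const_mul, intervalIntegral_inner hPc, ← hd,
        real_inner_self_eq_norm_sq]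
      · simp only [hH, intervalIntegral.integral_const, smul_eq_mul, sub_zero]
        ring
      all_goals exact Continuous.intervalIntegrable (by fun_prop) _ _
    rw [e]
    apply intervalIntegral.integral_mono_on hT.le
    · exact Continuous.intervalIntegrable (by fun_prop) _ _
    · exact Continuous.intervalIntegrable (by fun_prop) _ _
    · intro t _
      have := sqrt_one_add_norm_sq_add_le (l - W t) d (-(1 / T))
      rwa [sub_add_eq_add_sub] at this
  have h1 := hl (l + (-(1 / T)) • d)
  have h2 : (-(1 / T)) * ‖d‖ ^ 2 + T * ((1 / T) ^ 2 * ‖d‖ ^ 2 / 2) = -(‖d‖ ^ 2 * (1 / (2 * T))) := by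
    field_simp; ring
  have h3 : ‖d‖ ^ 2 * (1 / (2 * T)) ≤ 0 := by linarith
  have h4 : 0 < 1 / (2 * T) := by positivity
  have h5 : ‖d‖ ^ 2 ≤ 0 := nonpos_of_mul_nonpos_left h3 h4
  have h6 : ‖d‖ = 0 := pow_eq_zero_iff (two_ne_zero) |>.1 (le_antisymm h5 (sq_nonneg _))
  exact norm_eq_zero.1 h6

end RelativisticVelocity

/-! ### Regularity, periodicity and bounds of the potentials. -/

section Potentials

variable {T : ℝ} {S : Set E3} {A : ℝ → E3 → E3} {Φ : ℝ → E3 → ℝ}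

theorem exists_mem_Icc_eq_of_periodic {α : Type*} {f : ℝ → α} {T : ℝ} (hf : ∀ t, f (t + T) = f t)
    (hT : 0 < T) (t : ℝ) : ∃ s ∈ Icc 0 T, f s = f t := by
  obtain ⟨s, hs, h⟩ := Function.Periodic.exists_mem_Ico₀ hf hT t
  exact ⟨s, Ico_subset_Icc_self hs, h.symm⟩

theorem hasDerivAt_time (hA : ContDiff ℝ 1 (fun p : ℝ × E3 => A p.1 p.2)) (t : ℝ) (x : E3) :
    HasDerivAt (fun s => A s x) (fderiv ℝ (fun p : ℝ × E3 => A p.1 p.2) (t, x) (1, 0)) t := by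
  have h := (hA.differentiable one_ne_zero (t, x)).hasFDerivAt
  have h2 : HasDerivAt (fun s : ℝ => (s, x)) ((1 : ℝ), (0 : E3)) t :=
    (hasDerivAt_id t).prodMk (hasDerivAt_const t x)
  exact h.comp_hasDerivAt t h2

theorem timeDeriv_eq (hA : ContDiff ℝ 1 (fun p : ℝ × E3 => A p.1 p.2)) (t : ℝ) (x : E3) :
    timeDeriv A t x = fderiv ℝ (fun p : ℝ × E3 => A p.1 p.2) (t, x) (1, 0) :=
  (hasDerivAt_time hA t x).deriv

theorem hasFDerivAt_space (hA : ContDiff ℝ 1 (fun p : ℝ × E3 => A p.1 p.2)) (t : ℝ) (x : E3) :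
    HasFDerivAt (A t) ((fderiv ℝ (fun p : ℝ × E3 => A p.1 p.2) (t, x)).comp
      (ContinuousLinearMap.inr ℝ ℝ E3)) x := by
  have h := (hA.differentiable one_ne_zero (t, x)).hasFDerivAt
  exact h.comp x (hasFDerivAt_prodMk_right t x)

theorem fderiv_space_eq (hA : ContDiff ℝ 1 (fun p : ℝ × E3 => A p.1 p.2)) (t : ℝ) (x : E3) :
    fderiv ℝ (A t) x = (fderiv ℝ (fun p : ℝ × E3 => A p.1 p.2) (t, x)).comp
      (ContinuousLinearMap.inr ℝ ℝ E3) :=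
  (hasFDerivAt_space hA t x).fderiv

theorem continuous_timeDeriv (hA : ContDiff ℝ 1 (fun p : ℝ × E3 => A p.1 p.2)) :
    Continuous (fun p : ℝ × E3 => timeDeriv A p.1 p.2) := by
  have h := hA.continuous_fderiv one_ne_zero
  have e : (fun p : ℝ × E3 => timeDeriv A p.1 p.2)
      = fun p => fderiv ℝ (fun p : ℝ × E3 => A p.1 p.2) p (1, 0) := by
    ext1 p; exact timeDeriv_eq hA p.1 p.2
  rw [e]
  exact h.clm_apply continuous_const

theorem continuous_fderiv_space (hA : ContDiff ℝ 1 (fun p : ℝ × E3 => A p.1 p.2)) :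
    Continuous (fun p : ℝ × E3 => fderiv ℝ (A p.1) p.2) := by
  have h := hA.continuous_fderiv one_ne_zero
  have e : (fun p : ℝ × E3 => fderiv ℝ (A p.1) p.2)
      = fun p => (fderiv ℝ (fun p : ℝ × E3 => A p.1 p.2) p).comp
        (ContinuousLinearMap.inr ℝ ℝ E3) := by
    ext1 p; exact fderiv_space_eq hA p.1 p.2
  rw [e]
  exact h.clm_comp continuous_const

theorem differentiable_space (hA : ContDiff ℝ 1 (fun p : ℝ × E3 => A p.1 p.2)) (t : ℝ) :
    Differentiable ℝ (A t) := fun x => (hasFDerivAt_space hA t x).differentiableAt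

theorem hasDerivAt_along (hA : ContDiff ℝ 1 (fun p : ℝ × E3 => A p.1 p.2)) {q : ℝ → E3} {v : E3}
    {t : ℝ} (hq : HasDerivAt q v t) :
    HasDerivAt (fun s => A s (q s)) (timeDeriv A t (q t) + fderiv ℝ (A t) (q t) v) t := by
  have h := (hA.differentiable one_ne_zero (t, q t)).hasFDerivAt
  have h2 : HasDerivAt (fun s : ℝ => (s, q s)) ((1 : ℝ), v) t := (hasDerivAt_id t).prodMk hq
  have h3 := h.comp_hasDerivAt t h2
  have e : timeDeriv A t (q t) + fderiv ℝ (A t) (q t) v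
      = fderiv ℝ (fun p : ℝ × E3 => A p.1 p.2) (t, q t) (1, v) := by
    rw [timeDeriv_eq hA, fderiv_space_eq hA, ContinuousLinearMap.comp_apply, ← map_add]
    simp
  rw [e]
  exact h3

theorem IsVectorPotential.timeDeriv_periodic (hA : IsVectorPotential T A) (t : ℝ) (x : E3) :
    timeDeriv A (t + T) x = timeDeriv A t x := by
  have : (fun s => A (s + T) x) = fun s => A s x := by ext1 s; exact hA.periodic s x
  rw [timeDeriv, ← deriv_comp_add_const (f := fun s => A s x), this, timeDeriv]

theorem IsVectorPotential.fderiv_periodic (hA : IsVectorPotential T A) (t : ℝ) (x : E3) :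
    fderiv ℝ (A (t + T)) x = fderiv ℝ (A t) x := by
  have : A (t + T) = A t := funext (hA.periodic t)
  rw [this]

theorem IsVectorPotential.exists_far_bound (hA : IsVectorPotential T A) {ε : ℝ} (hε : 0 < ε) :
    ∃ R : ℝ, ∀ t x, R ≤ ‖x‖ → ‖timeDeriv A t x‖ ≤ ε ∧ ‖fderiv ℝ (A t) x‖ ≤ ε := by
  obtain ⟨R, hR⟩ := hA.decay ε hε
  refine ⟨R, fun t x hx => ?_⟩
  have h := lt_of_abs_lt (hR t x hx)
  constructor <;> linarith [norm_nonneg (timeDeriv A t x), norm_nonneg (fderiv ℝ (A t) x)]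

theorem IsVectorPotential.exists_bound (hT : 0 < T) (hA : IsVectorPotential T A) :
    ∃ C : ℝ, 0 ≤ C ∧ ∀ t x, ‖timeDeriv A t x‖ ≤ C ∧ ‖fderiv ℝ (A t) x‖ ≤ C := by
  obtain ⟨R, hR⟩ := hA.exists_far_bound one_pos
  have hK : IsCompact (Icc 0 T ×ˢ Metric.closedBall (0 : E3) R) :=
    isCompact_Icc.prod (isCompact_closedBall _ _)
  obtain ⟨C1, h1⟩ := hK.exists_bound_of_continuousOn (continuous_timeDeriv hA.contDiff).continuousOn
  obtain ⟨C2, h2⟩ :=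
    hK.exists_bound_of_continuousOn (continuous_fderiv_space hA.contDiff).continuousOn
  refine ⟨max 1 (max C1 C2), by positivity, fun t x => ?_⟩
  rcases le_or_gt R ‖x‖ with hx | hx
  · have := hR t x hx
    exact ⟨this.1.trans (le_max_left _ _), this.2.trans (le_max_left _ _)⟩
  · obtain ⟨s, hs, e⟩ := exists_mem_Icc_eq_of_periodic
      (f := fun t => (timeDeriv A t x, fderiv ℝ (A t) x))
      (fun t => by simp only [hA.timeDeriv_periodic, hA.fderiv_periodic]) hT t
    have hm : (s, x) ∈ Icc 0 T ×ˢ Metric.closedBall (0 : E3) R := ⟨hs, by simpa using hx.le⟩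
    rw [Prod.mk.injEq] at e
    rw [← e.1, ← e.2]
    exact ⟨(h1 _ hm).trans ((le_max_left _ _).trans (le_max_right _ _)),
      (h2 _ hm).trans ((le_max_right _ _).trans (le_max_right _ _))⟩

theorem norm_sub_le_of_fderiv_le (hA : ContDiff ℝ 1 (fun p : ℝ × E3 => A p.1 p.2)) {t C r : ℝ}
    {x y : E3} (hC : ∀ z ∈ Metric.closedBall x r, ‖fderiv ℝ (A t) z‖ ≤ C) (hr : 0 ≤ r)
    (hy : ‖y - x‖ ≤ r) : ‖A t y - A t x‖ ≤ C * ‖y - x‖ :=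
  Convex.norm_image_sub_le_of_norm_fderiv_le (fun z _ => differentiable_space hA t z) hC
    (convex_closedBall x r) (Metric.mem_closedBall_self hr)
    (by rwa [Metric.mem_closedBall, dist_eq_norm])

theorem norm_gradient (f : E3 → ℝ) (x : E3) : ‖gradient f x‖ = ‖fderiv ℝ f x‖ := by
  rw [gradient]; exact LinearIsometryEquiv.norm_map _ _

theorem inner_gradient (f : E3 → ℝ) (x h : E3) : inner ℝ (gradient f x) h = fderiv ℝ f x h := by
  rw [gradient, InnerProductSpace.toDual_symm_apply]

theorem IsScalarPotential.differentiableAt (hΦ : IsScalarPotential T S Φ) (hS : IsClosed S)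
    (t : ℝ) {x : E3} (hx : x ∉ S) : DifferentiableAt ℝ (Φ t) x :=
  ((hΦ.contDiffOn t).differentiableOn one_ne_zero).differentiableAt (hS.isOpen_compl.mem_nhds hx)

theorem IsScalarPotential.norm_sub_le (hΦ : IsScalarPotential T S Φ) (hS : IsClosed S)
    {t C : ℝ} {K : Set E3} (hK : Convex ℝ K) (hKS : ∀ z ∈ K, z ∉ S)
    (hC : ∀ z ∈ K, ‖gradient (Φ t) z‖ ≤ C) {x y : E3} (hx : x ∈ K) (hy : y ∈ K) :
    ‖Φ t y - Φ t x‖ ≤ C * ‖y - x‖ :=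
  hK.norm_image_sub_le_of_norm_fderiv_le (fun z hz => hΦ.differentiableAt hS t (hKS z hz))
    (fun z hz => (norm_gradient _ _).symm.le.trans (hC z hz)) hx hy

theorem IsScalarPotential.gradient_periodic (hΦ : IsScalarPotential T S Φ) (hS : IsClosed S)
    (t : ℝ) {x : E3} (hx : x ∉ S) : gradient (Φ (t + T)) x = gradient (Φ t) x := by
  have : Φ (t + T) =ᶠ[𝓝 x] Φ t := by
    filter_upwards [hS.isOpen_compl.mem_nhds hx] with y hy
    exact hΦ.periodic t y hy
  rw [gradient, gradient, this.fderiv_eq]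

theorem IsScalarPotential.continuousAt_gradient (hΦ : IsScalarPotential T S Φ) (hS : IsClosed S)
    (t : ℝ) {x : E3} (hx : x ∉ S) :
    ContinuousAt (fun p : ℝ × E3 => gradient (Φ p.1) p.2) (t, x) :=
  hΦ.continuousOn_gradient.continuousAt
    ((isOpen_univ.prod hS.isOpen_compl).mem_nhds ⟨mem_univ _, hx⟩)

/-- Only separate regularity of `Φ` is assumed. Continuity of the gradient bounds it near the point,
so `Φ t` is Lipschitz in space uniformly in nearby `t`; continuity in time at `x₀` does the rest. -/
theorem IsScalarPotential.continuousAt (hΦ : IsScalarPotential T S Φ) (hS : IsClosed S)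
    (t₀ : ℝ) {x₀ : E3} (hx₀ : x₀ ∉ S) :
    ContinuousAt (fun p : ℝ × E3 => Φ p.1 p.2) (t₀, x₀) := by
  set C := ‖gradient (Φ t₀) x₀‖ + 1 with hC
  have h1 : ∀ᶠ p : ℝ × E3 in 𝓝 (t₀, x₀), ‖gradient (Φ p.1) p.2‖ < C ∧ p.2 ∉ S := by
    refine ((hΦ.continuousAt_gradient hS t₀ hx₀).norm.eventually_lt_const ?_).and ?_
    · simp [hC]
    · exact continuous_snd.continuousAt.eventually
        (hS.isOpen_compl.mem_nhds (show x₀ ∈ Sᶜ from hx₀))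
  obtain ⟨δ, hδ, hball⟩ := Metric.eventually_nhds_iff_ball.1 h1
  have h2 : ∀ᶠ p : ℝ × E3 in 𝓝 (t₀, x₀), ‖Φ p.1 p.2 - Φ p.1 x₀‖ ≤ C * ‖p.2 - x₀‖ := by
    filter_upwards [Metric.ball_mem_nhds _ hδ] with p hp
    have hp' : dist p.1 t₀ < δ ∧ dist p.2 x₀ < δ := by
      rw [Metric.mem_ball, Prod.dist_eq, max_lt_iff] at hp
      exact hp
    have hm : ∀ z ∈ Metric.ball x₀ δ, ((p.1, z) : ℝ × E3) ∈ Metric.ball (t₀, x₀) δ := by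
      intro z hz
      rw [Metric.mem_ball, Prod.dist_eq]
      exact max_lt hp'.1 hz
    exact hΦ.norm_sub_le hS (convex_ball x₀ δ) (fun z hz => (hball _ (hm z hz)).2)
      (fun z hz => (hball _ (hm z hz)).1.le) (Metric.mem_ball_self hδ) hp'.2
  have h3 : Tendsto (fun p : ℝ × E3 => Φ p.1 p.2 - Φ p.1 x₀) (𝓝 (t₀, x₀)) (𝓝 0) := by
    apply squeeze_zero_norm' h2
    have : Continuous (fun p : ℝ × E3 => C * ‖p.2 - x₀‖) := by fun_prop
    simpa using this.tendsto (t₀, x₀)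
  have h4 : Tendsto (fun p : ℝ × E3 => Φ p.1 x₀) (𝓝 (t₀, x₀)) (𝓝 (Φ t₀ x₀)) :=
    ((hΦ.continuous_time x₀ hx₀).comp continuous_fst).tendsto (t₀, x₀)
  simpa [ContinuousAt] using h3.add h4

theorem IsScalarPotential.continuous_along (hΦ : IsScalarPotential T S Φ) (hS : IsClosed S)
    {q : ℝ → E3} (hq : Continuous q) (hqS : ∀ t, q t ∉ S) : Continuous (fun t => Φ t (q t)) :=
  continuous_iff_continuousAt.2 fun t =>
    ContinuousAt.comp (f := fun t => (t, q t)) (hΦ.continuousAt hS t (hqS t))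
      (continuous_id.prodMk hq).continuousAt

theorem IsScalarPotential.continuous_gradient_along (hΦ : IsScalarPotential T S Φ)
    (hS : IsClosed S) {q : ℝ → E3} (hq : Continuous q) (hqS : ∀ t, q t ∉ S) :
    Continuous (fun t => gradient (Φ t) (q t)) :=
  continuous_iff_continuousAt.2 fun t =>
    ContinuousAt.comp (f := fun t => (t, q t)) (hΦ.continuousAt_gradient hS t (hqS t))
      (continuous_id.prodMk hq).continuousAt

theorem IsScalarPotential.exists_gradient_bound (hT : 0 < T) (hΦ : IsScalarPotential T S Φ)
    (hS : IsClosed S) {N : Set E3} (hN : IsCompact N) (hNS : ∀ x ∈ N, x ∉ S) :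
    ∃ C : ℝ, 0 ≤ C ∧ ∀ t, ∀ x ∈ N, ‖gradient (Φ t) x‖ ≤ C := by
  obtain ⟨C, hC⟩ := (isCompact_Icc (a := 0) (b := T)).prod hN |>.exists_bound_of_continuousOn
    (hΦ.continuousOn_gradient.mono (prod_mono (subset_univ _) hNS))
  refine ⟨max C 0, le_max_right _ _, fun t x hx => ?_⟩
  obtain ⟨s, hs, e⟩ := exists_mem_Icc_eq_of_periodic
    (f := fun t => gradient (Φ t) x) (fun t => hΦ.gradient_periodic hS t (hNS x hx)) hT t
  rw [← e]
  exact (hC (s, x) ⟨hs, hx⟩).trans (le_max_left _ _)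

theorem IsScalarPotential.exists_bound (hΦ : IsScalarPotential T S Φ)
    (hS : IsClosed S) {N : Set E3} (hN : IsCompact N) (hNS : ∀ x ∈ N, x ∉ S) :
    ∃ C : ℝ, ∀ t ∈ Icc 0 T, ∀ x ∈ N, ‖Φ t x‖ ≤ C := by
  have hc : ContinuousOn (fun p : ℝ × E3 => Φ p.1 p.2) (Icc 0 T ×ˢ N) := fun p hp =>
    (hΦ.continuousAt hS p.1 (hNS p.2 hp.2)).continuousWithinAt
  obtain ⟨C, hC⟩ := ((isCompact_Icc (a := 0) (b := T)).prod hN).exists_bound_of_continuousOn hc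
  exact ⟨C, fun t ht x hx => hC (t, x) ⟨ht, hx⟩⟩

theorem IsScalarPotential.exists_far_bound (hΦ : IsScalarPotential T S Φ) {ε : ℝ} (hε : 0 < ε) :
    ∃ R : ℝ, ∀ t x, R ≤ ‖x‖ → ‖gradient (Φ t) x‖ ≤ ε := by
  obtain ⟨R, hR⟩ := hΦ.decay ε hε
  exact ⟨R, fun t x hx => (abs_norm (gradient (Φ t) x)).symm.le.trans (hR t x hx).le⟩

theorem exists_far_notMem (hS : IsCompact S) : ∃ R : ℝ, ∀ x : E3, R ≤ ‖x‖ → x ∉ S := by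
  obtain ⟨R, hR⟩ := hS.isBounded.exists_norm_le
  exact ⟨R + 1, fun x hx hxS => by linarith [hR x hxS]⟩

end Potentials

/-! ### Closed curves and their action. -/

section Loops

variable {T : ℝ} {S : Set E3} {A : ℝ → E3 → E3} {Φ : ℝ → E3 → ℝ} {q v : ℝ → E3}

/-- `q` is a closed curve of class `C¹` and period `T`, with velocity `v`. -/
structure IsLoop (T : ℝ) (q v : ℝ → E3) : Prop where
  hasDerivAt : ∀ t, HasDerivAt q (v t) t
  continuous_velocity : Continuous v
  periodic : ∀ t, q (t + T) = q t

theorem IsLoop.continuous (h : IsLoop T q v) : Continuous q :=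
  continuous_iff_continuousAt.2 fun t => (h.hasDerivAt t).continuousAt

theorem IsLoop.velocity_periodic (h : IsLoop T q v) (t : ℝ) : v (t + T) = v t := by
  have h1 : HasDerivAt (fun s => q (s + T)) (v (t + T)) t :=
    HasDerivAt.comp_add_const t T (h.hasDerivAt (t + T))
  have e : (fun s => q (s + T)) = q := funext h.periodic
  rw [e] at h1
  exact h1.unique (h.hasDerivAt t)

theorem IsLoop.integral_velocity (h : IsLoop T q v) (a b : ℝ) :
    ∫ t in a..b, v t = q b - q a :=
  intervalIntegral.integral_eq_sub_of_hasDerivAt (fun t _ => h.hasDerivAt t)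
    (h.continuous_velocity.intervalIntegrable _ _)

theorem IsLoop.integral_velocity_period (h : IsLoop T q v) : ∫ t in (0 : ℝ)..T, v t = 0 := by
  have := h.periodic 0
  rw [zero_add] at this
  rw [h.integral_velocity, this, sub_self]

theorem IsLoop.norm_sub_le (h : IsLoop T q v) (hv : ∀ t, ‖v t‖ ≤ 1) (s t : ℝ) :
    ‖q t - q s‖ ≤ |t - s| := by
  have := convex_univ.norm_image_sub_le_of_norm_hasDerivWithin_le (f := q) (C := 1)
    (fun x _ => (h.hasDerivAt x).hasDerivWithinAt) (fun x _ => hv x) (mem_univ s) (mem_univ t)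
  simpa using this

theorem IsLoop.norm_sub_zero_le (h : IsLoop T q v) (hT : 0 < T) (hv : ∀ t, ‖v t‖ ≤ 1) (t : ℝ) :
    ‖q t - q 0‖ ≤ T := by
  obtain ⟨s, hs, e⟩ := exists_mem_Icc_eq_of_periodic h.periodic hT t
  rw [← e]
  refine (h.norm_sub_le hv 0 s).trans ?_
  rw [sub_zero, abs_of_nonneg hs.1]
  exact hs.2

theorem isLoop_integral {x : E3} (hv : Continuous v) (hp : ∀ t, v (t + T) = v t)
    (h0 : ∫ t in (0 : ℝ)..T, v t = 0) : IsLoop T (fun t => x + ∫ s in (0 : ℝ)..t, v s) v where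
  hasDerivAt t := (intervalIntegral.integral_hasDerivAt_right (hv.intervalIntegrable _ _)
    hv.aestronglyMeasurable.stronglyMeasurableAtFilter hv.continuousAt).const_add x
  continuous_velocity := hv
  periodic t := by
    have h1 : ∫ s in t..t + T, v s = 0 := by
      rw [Function.Periodic.intervalIntegral_add_eq hp t 0, zero_add, h0]
    have h2 := intervalIntegral.integral_add_adjacent_intervals (μ := volume)
      (hv.intervalIntegrable 0 t) (hv.intervalIntegrable t (t + T))
    rw [h1, add_zero] at h2
    simp only [h2]

/-- The Lagrangian of a relativistic particle, normalised to have no rest energy. -/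
noncomputable def lagrangian (A : ℝ → E3 → E3) (Φ : ℝ → E3 → ℝ) (t : ℝ) (x v : E3) : ℝ :=
  (1 - √(1 - ‖v‖ ^ 2)) + inner ℝ v (A t x) - Φ t x

/-- The action of a loop. -/
noncomputable def action (T : ℝ) (A : ℝ → E3 → E3) (Φ : ℝ → E3 → ℝ) (q v : ℝ → E3) : ℝ :=
  ∫ t in (0 : ℝ)..T, lagrangian A Φ t (q t) (v t)

theorem IsAdmissible.continuous_lagrangian (h : IsAdmissible T S A Φ) (hS : IsClosed S)
    (hq : IsLoop T q v) (hqS : ∀ t, q t ∉ S) :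
    Continuous (fun t => lagrangian A Φ t (q t) (v t)) := by
  have h1 : Continuous (fun t => A t (q t)) :=
    h.vector.contDiff.continuous.comp (continuous_id.prodMk hq.continuous)
  have h2 := h.scalar.continuous_along hS hq.continuous hqS
  have h3 := hq.continuous_velocity
  have h4 : Continuous (fun t => 1 - √(1 - ‖v t‖ ^ 2)) := by fun_prop
  exact (h4.add (h3.inner h1)).sub h2

theorem IsAdmissible.lagrangian_periodic (h : IsAdmissible T S A Φ)
    (hq : IsLoop T q v) (hqS : ∀ t, q t ∉ S) :
    Function.Periodic (fun t => lagrangian A Φ t (q t) (v t)) T := by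
  intro t
  simp only [lagrangian, hq.velocity_periodic, hq.periodic, h.vector.periodic,
    h.scalar.periodic t (q t) (hqS t)]

theorem kinetic_nonneg {w : E3} : 0 ≤ 1 - √(1 - ‖w‖ ^ 2) := by
  have : √(1 - ‖w‖ ^ 2) ≤ 1 := Real.sqrt_le_one.2 (by nlinarith [sq_nonneg ‖w‖])
  linarith

end Loops

/-! ### Compactness in space of negative action levels. -/

section Confinement

variable {T : ℝ} {S : Set E3} {A : ℝ → E3 → E3} {Φ : ℝ → E3 → ℝ} {q v : ℝ → E3}

theorem norm_sub_le_of_timeDeriv_le (hA : ContDiff ℝ 1 (fun p : ℝ × E3 => A p.1 p.2)) {x : E3}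
    {C : ℝ} (hC : ∀ t, ‖timeDeriv A t x‖ ≤ C) (s t : ℝ) : ‖A t x - A s x‖ ≤ C * |t - s| := by
  have := convex_univ.norm_image_sub_le_of_norm_hasDerivWithin_le (f := fun s => A s x) (C := C)
    (fun t _ => (hasDerivAt_time hA t x).hasDerivWithinAt)
    (fun t _ => by rw [← timeDeriv_eq hA]; exact hC t) (mem_univ s) (mem_univ t)
  simpa using this

/-- Loops that venture far away have almost nonnegative action. -/
theorem IsAdmissible.exists_far_action_ge (h : IsAdmissible T S A Φ) (hT : 0 < T)
    (hS : IsCompact S) (hφ : ∀ x ∉ S, phiMean T Φ x ≤ 0) {ε : ℝ} (hε : 0 < ε) :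
    ∃ R : ℝ, ∀ q v : ℝ → E3, IsLoop T q v → (∀ t, ‖v t‖ ≤ 1) → (∀ t, q t ∉ S) →
      (∃ t, R ≤ ‖q t‖) → -ε ≤ action T A Φ q v := by
  -- Three errors of size `η T` (space and time variation of `A`, space variation of `Φ`),
  -- integrated over a period, add up to `ε`.
  set η := ε / (3 * T ^ 2) with hη
  have hη0 : 0 < η := by positivity
  obtain ⟨R1, h1⟩ := h.vector.exists_far_bound hη0
  obtain ⟨R2, h2⟩ := h.scalar.exists_far_bound hη0
  obtain ⟨R3, h3⟩ := exists_far_notMem hS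
  refine ⟨max R1 (max R2 R3) + 2 * T, fun q v hq hv hqS ⟨t1, ht1⟩ => ?_⟩
  have hfar : ∀ z ∈ Metric.closedBall (q 0) T, max R1 (max R2 R3) ≤ ‖z‖ := by
    intro z hz
    rw [Metric.mem_closedBall, dist_eq_norm] at hz
    have a1 := hq.norm_sub_zero_le hT hv t1
    have a2 : ‖q t1‖ ≤ ‖q t1 - q 0‖ + ‖z - q 0‖ + ‖z‖ := by
      have e : q t1 = (q t1 - q 0) - (z - q 0) + z := by abel
      calc ‖q t1‖ = ‖(q t1 - q 0) - (z - q 0) + z‖ := by rw [← e]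
        _ ≤ ‖(q t1 - q 0) - (z - q 0)‖ + ‖z‖ := norm_add_le _ _
        _ ≤ _ := by gcongr; exact norm_sub_le _ _
    linarith
  have f1 : ∀ z ∈ Metric.closedBall (q 0) T, R1 ≤ ‖z‖ := fun z hz =>
    (le_max_left _ _).trans (hfar z hz)
  have f2 : ∀ z ∈ Metric.closedBall (q 0) T, R2 ≤ ‖z‖ := fun z hz =>
    (le_max_left _ _).trans ((le_max_right _ _).trans (hfar z hz))
  have f3 : ∀ z ∈ Metric.closedBall (q 0) T, z ∉ S := fun z hz =>
    h3 z ((le_max_right _ _).trans ((le_max_right _ _).trans (hfar z hz)))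
  have hm0 : q 0 ∈ Metric.closedBall (q 0) T := Metric.mem_closedBall_self hT.le
  -- `A` is frozen at `(0, q 0)`, where its coupling integrates to zero on a closed loop, and `Φ` at
  -- `q 0`, where it integrates to `phiMean T Φ (q 0) ≤ 0`.
  have hpt : ∀ t ∈ Icc 0 T, inner ℝ (A 0 (q 0)) (v t) - Φ t (q 0) - 3 * η * T
      ≤ lagrangian A Φ t (q t) (v t) := by
    intro t ht
    have hqt := hq.norm_sub_zero_le hT hv t
    have hqm : q t ∈ Metric.closedBall (q 0) T := by rwa [Metric.mem_closedBall, dist_eq_norm]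
    have b1 : ‖A t (q t) - A t (q 0)‖ ≤ η * T :=
      (norm_sub_le_of_fderiv_le h.vector.contDiff (fun z hz => (h1 t z (f1 z hz)).2) hT.le hqt).trans
        (by gcongr)
    have b2 : ‖A t (q 0) - A 0 (q 0)‖ ≤ η * T := by
      refine (norm_sub_le_of_timeDeriv_le h.vector.contDiff
        (fun t => (h1 t (q 0) (f1 _ hm0)).1) 0 t).trans ?_
      rw [sub_zero, abs_of_nonneg ht.1]
      gcongr
      exact ht.2
    have b3 : ‖Φ t (q t) - Φ t (q 0)‖ ≤ η * T :=
      (h.scalar.norm_sub_le hS.isClosed (convex_closedBall (q 0) T) f3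
        (fun z hz => h2 t z (f2 z hz)) hm0 hqm).trans (by gcongr)
    have b4 : ‖A t (q t) - A 0 (q 0)‖ ≤ 2 * η * T := by
      have e : A t (q t) - A 0 (q 0) = (A t (q t) - A t (q 0)) + (A t (q 0) - A 0 (q 0)) := by abel
      rw [e]
      linarith [norm_add_le (A t (q t) - A t (q 0)) (A t (q 0) - A 0 (q 0))]
    have b5 : -(2 * η * T) ≤ inner ℝ (v t) (A t (q t) - A 0 (q 0)) := by
      have := neg_le_of_abs_le (abs_real_inner_le_norm (v t) (A t (q t) - A 0 (q 0)))
      have h6 : ‖v t‖ * ‖A t (q t) - A 0 (q 0)‖ ≤ 1 * (2 * η * T) :=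
        mul_le_mul (hv t) b4 (norm_nonneg _) zero_le_one
      linarith
    rw [inner_sub_right, real_inner_comm (A 0 (q 0)) (v t)] at b5
    have b6 := le_of_abs_le b3
    have b7 := kinetic_nonneg (w := v t)
    unfold lagrangian
    linarith
  have hint : ∫ t in (0 : ℝ)..T, (inner ℝ (A 0 (q 0)) (v t) - Φ t (q 0) - 3 * η * T)
      = - phiMean T Φ (q 0) - ε := by
    have hcv := hq.continuous_velocity
    have hcΦ := h.scalar.continuous_time (q 0) (hqS 0)
    rw [intervalIntegral.integral_sub, intervalIntegral.integral_sub, intervalIntegral_inner hcv,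
      hq.integral_velocity_period, inner_zero_right, intervalIntegral.integral_const, phiMean]
    · simp only [sub_zero, smul_eq_mul, hη]
      field_simp
      ring
    all_goals exact Continuous.intervalIntegrable (by fun_prop) _ _
  have hii : IntervalIntegrable (fun t => inner ℝ (A 0 (q 0)) (v t) - Φ t (q 0) - 3 * η * T)
      volume 0 T := by
    have hcv := hq.continuous_velocity
    have hcΦ := h.scalar.continuous_time (q 0) (hqS 0)
    exact Continuous.intervalIntegrable (by fun_prop) _ _
  have hmono := intervalIntegral.integral_mono_on hT.le hii
    ((h.continuous_lagrangian hS.isClosed hq hqS).intervalIntegrable 0 T) hpt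
  rw [hint] at hmono
  have := hφ (q 0) (hqS 0)
  unfold action
  linarith

theorem IsScalarPotential.apply_eq_of_mem_Icc (hΦ : IsScalarPotential T S Φ) (hT : 0 < T) (t : ℝ) :
    ∃ s ∈ Icc 0 T, ∀ x ∉ S, Φ s x = Φ t x := by
  obtain ⟨s, hs, e⟩ := exists_mem_Icc_eq_of_periodic (f := fun t => fun x : (Sᶜ : Set E3) => Φ t x)
    (fun t => funext fun x => hΦ.periodic t x x.2) hT t
  exact ⟨s, hs, fun x hx => congrFun e ⟨x, hx⟩⟩

/-- Compactness of a period makes `ε` and `r` independent of `t₀`, and periodicity extends the bound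
to all times. -/
theorem IsScalarPotential.coulomb_uniform (hΦ : IsScalarPotential T S Φ) (hT : 0 < T) {x₀ : E3}
    (hx₀ : x₀ ∈ frontier S) :
    ∃ ε > 0, ∃ r > 0, ∀ t, ∀ x ∉ S, ‖x - x₀‖ < ε → r / ‖x - x₀‖ ≤ -Φ t x := by
  have key : ∃ ε > 0, ∃ r > 0, ∀ t ∈ Icc 0 T, ∀ x ∉ S, ‖x - x₀‖ < ε → r / ‖x - x₀‖ ≤ -Φ t x := by
    refine isCompact_Icc.induction_on (p := fun s => ∃ ε > 0, ∃ r > 0, ∀ t ∈ s, ∀ x ∉ S,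
      ‖x - x₀‖ < ε → r / ‖x - x₀‖ ≤ -Φ t x) ?_ ?_ ?_ ?_
    · exact ⟨1, one_pos, 1, one_pos, fun t ht => ht.elim⟩
    · rintro s u hsu ⟨ε, hε, r, hr, hu⟩
      exact ⟨ε, hε, r, hr, fun t ht => hu t (hsu ht)⟩
    · rintro s u ⟨ε, hε, r, hr, hs⟩ ⟨ε', hε', r', hr', hu⟩
      refine ⟨min ε ε', lt_min hε hε', min r r', lt_min hr hr', ?_⟩
      rintro t (ht | ht) x hx hlt
      · refine le_trans ?_ (hs t ht x hx (hlt.trans_le (min_le_left _ _)))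
        gcongr; exact min_le_left _ _
      · refine le_trans ?_ (hu t ht x hx (hlt.trans_le (min_le_right _ _)))
        gcongr; exact min_le_right _ _
    · intro t₀ ht₀
      obtain ⟨ε, hε, r, hr, hb⟩ := hΦ.coulomb x₀ hx₀ t₀ ht₀
      refine ⟨Metric.ball t₀ ε, mem_nhdsWithin_of_mem_nhds (Metric.ball_mem_nhds _ hε), ε, hε, r, hr,
        fun t ht x hx hlt => hb t x hx hlt ?_⟩
      rwa [Metric.mem_ball, Real.dist_eq] at ht
  obtain ⟨ε, hε, r, hr, hb⟩ := key
  refine ⟨ε, hε, r, hr, fun t x hx hlt => ?_⟩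
  obtain ⟨s, hs, e⟩ := hΦ.apply_eq_of_mem_Icc hT t
  rw [← e x hx]
  exact hb s hs x hx hlt

/-- Loops that come close to a singularity have nonnegative action. -/
theorem IsAdmissible.exists_near_action_nonneg (h : IsAdmissible T S A Φ) (hT : 0 < T)
    (hS : IsCompact S) {x₀ : E3} (hx₀ : x₀ ∈ frontier S) :
    ∃ d > 0, ∀ q v : ℝ → E3, IsLoop T q v → (∀ t, ‖v t‖ ≤ 1) → (∀ t, q t ∉ S) →
      (∃ t, ‖q t - x₀‖ < d) → 0 ≤ action T A Φ q v := by
  obtain ⟨ε, hε, r, hr, hb⟩ := h.scalar.coulomb_uniform hT hx₀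
  obtain ⟨C', hC'⟩ := h.scalar.bddAbove
  obtain ⟨C, hC0, hC⟩ : ∃ C : ℝ, 0 ≤ C ∧ ∀ t, ∀ x ∉ S, Φ t x ≤ C :=
    ⟨max C' 0, le_max_right _ _, fun t x hx => (hC' t x hx).trans (le_max_left _ _)⟩
  obtain ⟨D, hD⟩ : ∃ D : ℝ, ∀ t, ∀ x ∈ Metric.closedBall x₀ (1 + T), ‖A t x‖ ≤ D := by
    obtain ⟨D, hD⟩ := ((isCompact_Icc (a := 0) (b := T)).prod
      (isCompact_closedBall x₀ (1 + T))).exists_bound_of_continuousOn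
      h.vector.contDiff.continuous.continuousOn
    refine ⟨D, fun t x hx => ?_⟩
    obtain ⟨s, hs, e⟩ := exists_mem_Icc_eq_of_periodic (f := fun t => A t x)
      (fun t => h.vector.periodic t x) hT t
    rw [← e]
    exact hD (s, x) ⟨hs, hx⟩
  set K := (D + r / ε + C) * T with hK
  -- Chosen so that `r log ((d + T) / d) ≥ K`, where `K` bounds all the other losses over a period;
  -- `d ≤ 1` keeps the loop in the ball where `D` bounds `A`.
  set d := min 1 (T * Real.exp (-(K / r))) with hd
  have hd0 : 0 < d := lt_min one_pos (by positivity)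
  refine ⟨d, hd0, fun q v hq hv hqS ⟨t1, ht1⟩ => ?_⟩
  have hx₀S : x₀ ∈ S := hS.isClosed.frontier_subset hx₀
  -- Speed at most one gives `‖q t - x₀‖ ≤ d + (t - t1)`. The period is started at `t1`, the time of
  -- close approach, and shifted back by periodicity.
  have hpt : ∀ t ∈ Icc t1 (t1 + T), r / (d + (t - t1)) - (D + r / ε + C)
      ≤ lagrangian A Φ t (q t) (v t) := by
    intro t ht
    have a1 : ‖q t - x₀‖ ≤ d + (t - t1) := by
      have e : q t - x₀ = (q t - q t1) + (q t1 - x₀) := by abel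
      have := hq.norm_sub_le hv t1 t
      rw [abs_of_nonneg (by linarith [ht.1])] at this
      rw [e]
      linarith [norm_add_le (q t - q t1) (q t1 - x₀)]
    have a2 : ‖A t (q t)‖ ≤ D := by
      apply hD
      rw [Metric.mem_closedBall, dist_eq_norm]
      linarith [min_le_left 1 (T * Real.exp (-(K / r))), ht.2]
    have a3 : -D ≤ inner ℝ (v t) (A t (q t)) := by
      have := neg_le_of_abs_le (abs_real_inner_le_norm (v t) (A t (q t)))
      have h6 : ‖v t‖ * ‖A t (q t)‖ ≤ 1 * D :=
        mul_le_mul (hv t) a2 (norm_nonneg _) zero_le_one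
      linarith
    have a4 : 0 < ‖q t - x₀‖ := by
      rw [norm_pos_iff, sub_ne_zero]
      rintro e
      exact hqS t (e ▸ hx₀S)
    have a5 : r / (d + (t - t1)) - r / ε - C ≤ - Φ t (q t) := by
      rcases lt_or_ge ‖q t - x₀‖ ε with hlt | hge
      · have := hb t (q t) (hqS t) hlt
        have h7 : r / (d + (t - t1)) ≤ r / ‖q t - x₀‖ := by gcongr
        have h8 : 0 < r / ε := by positivity
        linarith
      · have h7 : r / (d + (t - t1)) ≤ r / ε := by gcongr; linarith
        linarith [hC t (q t) (hqS t)]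
    have b7 := kinetic_nonneg (w := v t)
    unfold lagrangian
    linarith
  have hderiv : ∀ t ∈ uIcc t1 (t1 + T),
      HasDerivAt (fun t => r * Real.log (d + (t - t1))) (r / (d + (t - t1))) t := by
    intro t ht
    rw [uIcc_of_le (by linarith)] at ht
    have hne : d + (t - t1) ≠ 0 := by linarith [ht.1]
    have h0 : HasDerivAt (fun t => d + (t - t1)) 1 t :=
      ((hasDerivAt_id t).sub_const t1).const_add d
    have := (h0.log hne).const_mul r
    rwa [mul_one_div] at this
  have hii : IntervalIntegrable (fun t => r / (d + (t - t1))) volume t1 (t1 + T) := by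
    apply ContinuousOn.intervalIntegrable
    intro t ht
    rw [uIcc_of_le (by linarith)] at ht
    have hne : d + (t - t1) ≠ 0 := by linarith [ht.1]
    have : ContinuousAt (fun t => r / (d + (t - t1))) t :=
      continuousAt_const.div (Continuous.continuousAt (by fun_prop)) hne
    exact this.continuousWithinAt
  have hint : ∫ t in t1..t1 + T, (r / (d + (t - t1)) - (D + r / ε + C))
      = r * Real.log (d + T) - r * Real.log d - K := by
    rw [intervalIntegral.integral_sub hii (by simp),
      intervalIntegral.integral_eq_sub_of_hasDerivAt hderiv hii]
    simp [hK]
    ring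
  have hmono := intervalIntegral.integral_mono_on (by linarith)
    (hii.sub (by simp))
    ((h.continuous_lagrangian hS.isClosed hq hqS).intervalIntegrable t1 (t1 + T)) hpt
  rw [hint, (h.lagrangian_periodic hq hqS).intervalIntegral_add_eq t1 0, zero_add] at hmono
  have hlog : Real.log d ≤ Real.log T - K / r := by
    have : Real.log d ≤ Real.log (T * Real.exp (-(K / r))) :=
      Real.log_le_log hd0 (min_le_right _ _)
    rwa [Real.log_mul hT.ne' (Real.exp_ne_zero _), Real.log_exp, ← sub_eq_add_neg] at this
  have hlog2 : Real.log T ≤ Real.log (d + T) := Real.log_le_log hT (by linarith)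
  have hfin : K ≤ r * (Real.log (d + T) - Real.log d) := by
    have h9 : K / r ≤ Real.log (d + T) - Real.log d := by linarith
    rwa [div_le_iff₀' hr] at h9
  unfold action
  linarith

/-- Loops whose action is below a negative level stay in a compact set of regular points. -/
theorem IsAdmissible.exists_compact_confinement (h : IsAdmissible T S A Φ) (hT : 0 < T)
    (hS : IsCompact S) (hφ : ∀ x ∉ S, phiMean T Φ x ≤ 0) {c : ℝ} (hc : 0 < c) :
    ∃ N : Set E3, IsCompact N ∧ (∀ x ∈ N, x ∉ S) ∧
      ∀ q v : ℝ → E3, IsLoop T q v → (∀ t, ‖v t‖ ≤ 1) → (∀ t, q t ∉ S) →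
        action T A Φ q v ≤ -c → ∀ t, q t ∈ N := by
  obtain ⟨R, hR⟩ := h.exists_far_action_ge hT hS hφ (half_pos hc)
  choose! d hd0 hd using fun x₀ (hx₀ : x₀ ∈ frontier S) => h.exists_near_action_nonneg hT hS hx₀
  -- `R` belongs to the level `-c / 2`, strictly above `-c`. Removing the interior of `S` and a ball
  -- about each frontier point leaves a closed set disjoint from `S`.
  set U : Set E3 := interior S ∪ ⋃ x₀ ∈ frontier S, Metric.ball x₀ (d x₀) with hU
  have hUo : IsOpen U :=
    isOpen_interior.union (isOpen_biUnion fun _ _ => Metric.isOpen_ball)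
  refine ⟨Metric.closedBall 0 R \ U, (isCompact_closedBall 0 R).diff hUo, ?_, ?_⟩
  · rintro x ⟨-, hxU⟩ hxS
    apply hxU
    by_cases hx : x ∈ interior S
    · exact Or.inl hx
    · have hf : x ∈ frontier S := ⟨subset_closure hxS, hx⟩
      exact Or.inr (mem_biUnion hf (Metric.mem_ball_self (hd0 x hf)))
  · intro q v hq hv hqS hact t
    constructor
    · rw [mem_closedBall_zero_iff]
      by_contra! hlt
      have := hR q v hq hv hqS ⟨t, hlt.le⟩
      linarith
    · rintro (hi | hu)
      · exact hqS t (interior_subset hi)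
      · simp only [mem_iUnion, Metric.mem_ball, dist_eq_norm] at hu
        obtain ⟨x₀, hx₀, hlt⟩ := hu
        have := hd x₀ hx₀ q v hq hv hqS ⟨t, hlt⟩
        linarith

end Confinement

/-! ### A loop of negative action. -/

section TestLoop

variable {T : ℝ} {S : Set E3} {A : ℝ → E3 → E3} {Φ : ℝ → E3 → ℝ}

theorem IsVectorPotential.hasDerivAt_oscillation (hA : IsVectorPotential T A) (t : ℝ) (x : E3) :
    HasDerivAt (fun t => oscillation T A t x) (timeDeriv A t x) t := by
  rw [timeDeriv_eq hA.contDiff]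
  exact (hasDerivAt_time hA.contDiff t x).sub_const _

theorem IsVectorPotential.continuous_oscillation (hA : IsVectorPotential T A) (x : E3) :
    Continuous (fun t => oscillation T A t x) :=
  continuous_iff_continuousAt.2 fun t => (hA.hasDerivAt_oscillation t x).continuousAt

theorem IsVectorPotential.oscillation_periodic (hA : IsVectorPotential T A) (t : ℝ) (x : E3) :
    oscillation T A (t + T) x = oscillation T A t x := by
  rw [oscillation, oscillation, hA.periodic]

theorem IsVectorPotential.continuous_time (hA : IsVectorPotential T A) (x : E3) :
    Continuous (fun t => A t x) :=
  hA.contDiff.continuous.comp (continuous_id.prodMk continuous_const)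

theorem IsVectorPotential.integral_oscillation (hT : 0 < T) (hA : IsVectorPotential T A) (x : E3) :
    ∫ t in (0 : ℝ)..T, oscillation T A t x = 0 := by
  unfold oscillation
  rw [intervalIntegral.integral_sub ((hA.continuous_time x).intervalIntegrable _ _) (by simp),
    intervalIntegral.integral_const, smul_smul, sub_zero, mul_one_div_cancel hT.ne', one_smul,
    sub_self]

/-- `Ã` at time `s` is the average over `u` of `A s x - A u x`, and two times in one period differ
by at most `T`. -/
theorem IsVectorPotential.norm_oscillation_le (hT : 0 < T) (hA : IsVectorPotential T A) {x : E3}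
    {η : ℝ} (hη : ∀ t, ‖timeDeriv A t x‖ ≤ η) (t : ℝ) : ‖oscillation T A t x‖ ≤ η * T := by
  obtain ⟨s, hs, e⟩ := exists_mem_Icc_eq_of_periodic (f := fun t => oscillation T A t x)
    (fun t => hA.oscillation_periodic t x) hT t
  rw [← e]
  have hη0 : 0 ≤ η := (norm_nonneg _).trans (hη 0)
  have e1 : oscillation T A s x = (1 / T) • ∫ u in (0 : ℝ)..T, (A s x - A u x) := by
    rw [intervalIntegral.integral_sub (by simp) ((hA.continuous_time x).intervalIntegrable _ _),
      intervalIntegral.integral_const, smul_sub, smul_smul, sub_zero, one_div_mul_cancel hT.ne',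
      one_smul, oscillation]
  have h2 : ‖∫ u in (0 : ℝ)..T, (A s x - A u x)‖ ≤ η * T * |T - 0| := by
    apply intervalIntegral.norm_integral_le_of_norm_le_const
    intro u hu
    rw [uIoc_of_le hT.le] at hu
    refine (norm_sub_le_of_timeDeriv_le hA.contDiff hη u s).trans ?_
    gcongr
    rw [abs_le]
    constructor <;> linarith [hs.1, hs.2, hu.1, hu.2]
  rw [sub_zero, abs_of_pos hT] at h2
  rw [e1, norm_smul, Real.norm_of_nonneg (by positivity), one_div_mul_eq_div, div_le_iff₀ hT]
  exact h2

theorem oscL2_sq (hT : 0 < T) (x : E3) :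
    oscL2 T A x ^ 2 = ∫ t in (0 : ℝ)..T, ‖oscillation T A t x‖ ^ 2 :=
  Real.sq_sqrt (intervalIntegral.integral_nonneg hT.le fun _ _ => by positivity)

theorem eq_zero_of_integral_norm_sq_nonpos {V : Type*} [NormedAddCommGroup V] (hT : 0 < T)
    {f : ℝ → V} (hf : Continuous f) (hp : ∀ t, f (t + T) = f t)
    (h : ∫ t in (0 : ℝ)..T, ‖f t‖ ^ 2 ≤ 0) (t : ℝ) : f t = 0 := by
  obtain ⟨s, hs, e⟩ := exists_mem_Icc_eq_of_periodic hp hT t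
  rw [← e]
  by_contra hne
  have : 0 < ∫ t in (0 : ℝ)..T, ‖f t‖ ^ 2 :=
    intervalIntegral.integral_pos hT (by fun_prop) (fun _ _ => by positivity)
      ⟨s, hs, by have := norm_pos_iff.2 hne; positivity⟩
  linarith

theorem IsVectorPotential.oscL2_pos (hT : 0 < T) (hA : IsVectorPotential T A) {x : E3}
    (hx : ∃ t, timeDeriv A t x ≠ 0) : 0 < oscL2 T A x := by
  refine (Real.sqrt_nonneg _).lt_of_ne' fun h0 => ?_
  obtain ⟨t, ht⟩ := hx
  have h1 : ∫ t in (0 : ℝ)..T, ‖oscillation T A t x‖ ^ 2 ≤ 0 := by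
    rw [← oscL2_sq hT]
    simp [oscL2, h0]
  have h2 := eq_zero_of_integral_norm_sq_nonpos hT (hA.continuous_oscillation x)
    (fun t => hA.oscillation_periodic t x) h1
  have h3 := hA.hasDerivAt_oscillation t x
  rw [show (fun t => oscillation T A t x) = fun _ => 0 from funext h2] at h3
  exact ht (h3.unique (hasDerivAt_const t 0))

/-- Cauchy–Schwarz, obtained from the nonnegative integral of `(‖f t‖ - m / T)²`. -/
theorem sq_integral_norm_le {V : Type*} [NormedAddCommGroup V] (hT : 0 < T) {f : ℝ → V}
    (hf : Continuous f) :
    (∫ t in (0 : ℝ)..T, ‖f t‖) ^ 2 ≤ T * ∫ t in (0 : ℝ)..T, ‖f t‖ ^ 2 := by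
  set m := ∫ t in (0 : ℝ)..T, ‖f t‖ with hm
  have h1 : 0 ≤ ∫ t in (0 : ℝ)..T, (‖f t‖ ^ 2 - 2 * (m / T) * ‖f t‖ + (m / T) ^ 2) := by
    apply intervalIntegral.integral_nonneg hT.le
    intro t _
    nlinarith [sq_nonneg (‖f t‖ - m / T)]
  rw [intervalIntegral.integral_add, intervalIntegral.integral_sub,
    intervalIntegral.integral_const_mul, intervalIntegral.integral_const, ← hm, sub_zero,
    smul_eq_mul] at h1
  · have h2 : T * (2 * (m / T) * m - T * (m / T) ^ 2) = m ^ 2 := by field_simp; ring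
    rw [← h2]
    exact mul_le_mul_of_nonneg_left (by linarith) hT.le
  all_goals exact Continuous.intervalIntegrable (by fun_prop) _ _

theorem one_sub_sqrt_le {x : ℝ} (h0 : 0 ≤ x) (h1 : x ≤ 1 / 4) : 1 - √(1 - x) ≤ 3 / 4 * x := by
  have : 1 - 3 / 4 * x ≤ √(1 - x) := Real.le_sqrt_of_sq_le (by nlinarith)
  linarith

theorem norm_gradient_le_farGradient {R R₀ ε : ℝ} (hR : R₀ ≤ R)
    (hfar : ∀ t x, R₀ ≤ ‖x‖ → ‖gradient (Φ t) x‖ ≤ ε) {t : ℝ} (ht : t ∈ Icc 0 T) {x : E3}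
    (hxS : x ∉ S) (hx : R ≤ ‖x‖) : ‖gradient (Φ t) x‖ ≤ farGradient T S Φ R := by
  apply le_csSup
  · refine ⟨ε, ?_⟩
    rintro g ⟨t, -, y, -, hy, rfl⟩
    exact hfar t y (hR.trans hy)
  · exact ⟨t, ht, x, hxS, hx, rfl⟩

/-- The action of the loop through `x` with velocity `-Ã(·, x)`. -/
theorem IsAdmissible.action_oscillation_loop_le (h : IsAdmissible T S A Φ) (hT : 0 < T)
    (hS : IsClosed S) {x : E3} {δ g : ℝ} (hosc : ∀ t, ‖oscillation T A t x‖ ≤ 1 / 2)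
    (hball : ∀ z ∈ Metric.closedBall x T, z ∉ S)
    (hδ : ∀ t, ∀ z ∈ Metric.closedBall x T, ‖fderiv ℝ (A t) z‖ ≤ δ)
    (hg : ∀ t ∈ Icc 0 T, ∀ z ∈ Metric.closedBall x T, ‖gradient (Φ t) z‖ ≤ g)
    {q : ℝ → E3} (hq : IsLoop T q (fun t => -oscillation T A t x)) (hq0 : q 0 = x) :
    action T A Φ q (fun t => -oscillation T A t x) ≤
      (-1 / 4 + δ * T) * oscL2 T A x ^ 2 - phiMean T Φ x + T * √T * g * oscL2 T A x := by
  set v : ℝ → E3 := fun t => -oscillation T A t x with hv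
  have hv2 : ∀ t, ‖v t‖ ≤ 1 / 2 := fun t => by simpa [hv] using hosc t
  have hv1 : ∀ t, ‖v t‖ ≤ 1 := fun t => (hv2 t).trans (by norm_num)
  have hcv : Continuous v := hq.continuous_velocity
  have hqm : ∀ t, q t ∈ Metric.closedBall x T := fun t => by
    rw [Metric.mem_closedBall, dist_eq_norm, ← hq0]
    exact hq.norm_sub_zero_le hT hv1 t
  have hqS : ∀ t, q t ∉ S := fun t => hball _ (hqm t)
  have hxm : x ∈ Metric.closedBall x T := Metric.mem_closedBall_self hT.le
  have h0m : (0 : ℝ) ∈ Icc 0 T := ⟨le_rfl, hT.le⟩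
  have hδ0 : 0 ≤ δ := (norm_nonneg _).trans (hδ 0 x hxm)
  have hg0 : 0 ≤ g := (norm_nonneg _).trans (hg 0 h0m x hxm)
  set m := ∫ t in (0 : ℝ)..T, ‖v t‖ with hm
  have hm0 : 0 ≤ m := intervalIntegral.integral_nonneg hT.le fun _ _ => norm_nonneg _
  have hL0 : 0 ≤ oscL2 T A x := Real.sqrt_nonneg _
  have hL2 : ∫ t in (0 : ℝ)..T, ‖v t‖ ^ 2 = oscL2 T A x ^ 2 := by
    rw [oscL2_sq hT]; simp only [hv, norm_neg]
  have hmL2 : m ^ 2 ≤ T * oscL2 T A x ^ 2 := by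
    rw [← hL2]; exact sq_integral_norm_le hT hcv
  have hmL : m ≤ √T * oscL2 T A x := by
    refine le_of_pow_le_pow_left₀ two_ne_zero (by positivity) ?_
    rwa [mul_pow, Real.sq_sqrt hT.le]
  have hdist : ∀ t ∈ Icc 0 T, ‖q t - x‖ ≤ m := by
    intro t ht
    rw [← hq0, ← hq.integral_velocity]
    refine (intervalIntegral.norm_integral_le_integral_norm ht.1).trans ?_
    apply intervalIntegral.integral_mono_interval le_rfl ht.1 ht.2
    · exact Eventually.of_forall fun _ => norm_nonneg _
    · exact hcv.norm.intervalIntegrable _ _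
  set a : E3 := (1 / T) • ∫ s in (0 : ℝ)..T, A s x with ha
  have hpt : ∀ t ∈ Icc 0 T, lagrangian A Φ t (q t) (v t) ≤
      -1 / 4 * ‖v t‖ ^ 2 + inner ℝ a (v t) + δ * m * ‖v t‖ - Φ t x + g * m := by
    intro t ht
    have hqt : ‖q t - x‖ ≤ T := by
      have := hqm t
      rwa [Metric.mem_closedBall, dist_eq_norm] at this
    have b1 : ‖A t (q t) - A t x‖ ≤ δ * m :=
      (norm_sub_le_of_fderiv_le h.vector.contDiff (hδ t) hT.le hqt).trans
        (by gcongr; exact hdist t ht)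
    have b3 : ‖Φ t (q t) - Φ t x‖ ≤ g * m :=
      (h.scalar.norm_sub_le hS (convex_closedBall x T) hball (hg t ht) hxm (hqm t)).trans
        (by gcongr; exact hdist t ht)
    -- `A` splits into a small displacement term, `Ã = -v` and the time mean `a`. The middle term
    -- pairs with `v` to give `-‖v‖²`, and the mean drops out on integration.
    have b4 : A t (q t) = (A t (q t) - A t x) + -v t + a := by
      simp only [hv, oscillation, ← ha]; abel
    have b5 : inner ℝ (v t) (A t (q t)) ≤ δ * m * ‖v t‖ - ‖v t‖ ^ 2 + inner ℝ a (v t) := by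
      rw [b4, inner_add_right, inner_add_right, inner_neg_right, real_inner_self_eq_norm_sq,
        real_inner_comm a (v t)]
      have := real_inner_le_norm (v t) (A t (q t) - A t x)
      have h6 : ‖v t‖ * ‖A t (q t) - A t x‖ ≤ ‖v t‖ * (δ * m) := by gcongr
      linarith
    have b6 := neg_le_of_abs_le b3
    -- The kinetic cost is at most `3/4 ‖v‖²` because `‖v‖ ≤ 1/2`; against the gain `-‖v‖²` this
    -- leaves `-1/4`.
    have b7 : 1 - √(1 - ‖v t‖ ^ 2) ≤ 3 / 4 * ‖v t‖ ^ 2 :=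
      one_sub_sqrt_le (by positivity) (by nlinarith [norm_nonneg (v t), hv2 t])
    unfold lagrangian
    linarith
  have hcΦ := h.scalar.continuous_time x (hball x hxm)
  have hii : IntervalIntegrable (fun t => -1 / 4 * ‖v t‖ ^ 2 + inner ℝ a (v t) + δ * m * ‖v t‖
      - Φ t x + g * m) volume 0 T := Continuous.intervalIntegrable (by fun_prop) _ _
  have hmono := intervalIntegral.integral_mono_on hT.le
    ((h.continuous_lagrangian hS hq hqS).intervalIntegrable 0 T) hii hpt
  have hint : ∫ t in (0 : ℝ)..T, (-1 / 4 * ‖v t‖ ^ 2 + inner ℝ a (v t) + δ * m * ‖v t‖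
      - Φ t x + g * m) = -1 / 4 * oscL2 T A x ^ 2 + δ * m * m - phiMean T Φ x + T * (g * m) := by
    rw [intervalIntegral.integral_add, intervalIntegral.integral_sub,
      intervalIntegral.integral_add, intervalIntegral.integral_add,
      intervalIntegral.integral_const_mul, intervalIntegral.integral_const_mul, hL2, ← hm,
      intervalIntegral_inner hcv, hq.integral_velocity_period, inner_zero_right, add_zero,
      intervalIntegral.integral_const, phiMean, smul_eq_mul, sub_zero]
    all_goals exact Continuous.intervalIntegrable (by fun_prop) _ _
  rw [hint] at hmono
  refine hmono.trans ?_
  have k1 : δ * m * m ≤ δ * (T * oscL2 T A x ^ 2) := by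
    rw [mul_assoc, ← sq]; gcongr
  have k2 : T * (g * m) ≤ T * (g * (√T * oscL2 T A x)) := by gcongr
  linarith

/-- For large `n` the gain `-‖Ã‖₂² / 4` beats all errors. The speed margin and the Lipschitz bound
on the velocity make the loop an admissible competitor later on. -/
theorem IsAdmissible.exists_action_neg (h : IsAdmissible T S A Φ) (hT : 0 < T)
    (hS : IsCompact S) {b : ℕ → E3} (hb : Tendsto (fun n => ‖b n‖) atTop atTop)
    (hosc : ∀ n, ∃ t, timeDeriv A t (b n) ≠ 0)
    (hmean : Tendsto (fun n => phiMean T Φ (b n) * (oscL2 T A (b n) ^ 2)⁻¹) atTop (𝓝 0))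
    (hgrad : Tendsto (fun n => farGradient T S Φ (‖b n‖ - T) * (oscL2 T A (b n))⁻¹)
      atTop (𝓝 0)) :
    ∃ q v : ℝ → E3, ∃ M : NNReal, IsLoop T q v ∧ (∀ t, ‖v t‖ ≤ 1 / 2) ∧ LipschitzWith M v ∧
      (∀ t, q t ∉ S) ∧ action T A Φ q v < 0 := by
  obtain ⟨R1, h1⟩ := h.vector.exists_far_bound (ε := 1 / (16 * T)) (by positivity)
  obtain ⟨R1', h1'⟩ := h.vector.exists_far_bound (ε := 1 / (2 * T)) (by positivity)
  obtain ⟨R2, h2⟩ := h.scalar.exists_far_bound one_pos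
  obtain ⟨R3, h3⟩ := exists_far_notMem hS
  obtain ⟨C, hC0, hC⟩ := h.vector.exists_bound hT
  have hbT : Tendsto (fun n => ‖b n‖ - T) atTop atTop := tendsto_atTop_add_const_right _ _ hb
  -- The three errors (from the space derivative of `A`, `-φ` and `∇Φ`) are each held to `‖Ã‖₂² /
  -- 16`, so `-1/4 + 3/16 < 0` remains. `R1'` makes the speed at most `1/2`.
  obtain ⟨n, hn1, hn1', hn2, hn3, hnφ, hng⟩ :=
    ((hbT.eventually_ge_atTop R1).and ((hbT.eventually_ge_atTop R1').and
    ((hbT.eventually_ge_atTop R2).and ((hbT.eventually_ge_atTop R3).and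
    ((hmean.eventually_const_lt (show (-1 / 16 : ℝ) < 0 by norm_num)).and
    (hgrad.eventually_lt_const (show (0 : ℝ) < 1 / (16 * (T * √T)) by positivity))))))).exists
  set x := b n with hx
  have hLpos : 0 < oscL2 T A x := h.vector.oscL2_pos hT (hosc n)
  have hfar : ∀ z ∈ Metric.closedBall x T, ‖x‖ - T ≤ ‖z‖ := by
    intro z hz
    rw [Metric.mem_closedBall, dist_eq_norm, norm_sub_rev] at hz
    linarith [norm_sub_norm_le x z]
  have hx0 : ‖x‖ - T ≤ ‖x‖ := by linarith
  have hsmall : ∀ t, ‖oscillation T A t x‖ ≤ 1 / 2 := by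
    intro t
    refine (h.vector.norm_oscillation_le hT (fun t => (h1' t x (hn1'.trans hx0)).1) t).trans ?_
    apply le_of_eq
    field_simp
  have hloop : IsLoop T (fun t => x + ∫ s in (0 : ℝ)..t, -oscillation T A s x)
      (fun t => -oscillation T A t x) :=
    isLoop_integral (h.vector.continuous_oscillation x).neg
      (fun t => by rw [h.vector.oscillation_periodic])
      (by rw [intervalIntegral.integral_neg, h.vector.integral_oscillation hT, neg_zero])
  have hball : ∀ z ∈ Metric.closedBall x T, z ∉ S := fun z hz => h3 z (hn3.trans (hfar z hz))
  have hact := h.action_oscillation_loop_le hT hS.isClosed hsmall hball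
    (fun t z hz => (h1 t z (hn1.trans (hfar z hz))).2)
    (fun t ht z hz => norm_gradient_le_farGradient hn2 h2 ht (hball z hz) (hfar z hz))
    hloop (by simp)
  refine ⟨_, _, ⟨C, hC0⟩, hloop, fun t => by simpa using hsmall t, ?_, ?_, ?_⟩
  · apply lipschitzWith_of_nnnorm_deriv_le
    · exact fun t => (h.vector.hasDerivAt_oscillation t x).neg.differentiableAt
    · intro t
      rw [(h.vector.hasDerivAt_oscillation t x).fun_neg.deriv, nnnorm_neg]
      exact (hC t x).1
  · intro t
    apply hball
    rw [Metric.mem_closedBall, dist_eq_norm]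
    have := hloop.norm_sub_zero_le hT (fun t => by
      rw [norm_neg]; exact (hsmall t).trans (by norm_num)) t
    simpa using this
  · refine hact.trans_lt ?_
    rw [← div_eq_mul_inv, lt_div_iff₀ (by positivity)] at hnφ
    rw [← div_eq_mul_inv, div_lt_iff₀ hLpos] at hng
    have k1 : T * √T * farGradient T S Φ (‖x‖ - T) * oscL2 T A x
        ≤ T * √T * (1 / (16 * (T * √T)) * oscL2 T A x) * oscL2 T A x := by gcongr
    have k2 : T * √T * (1 / (16 * (T * √T)) * oscL2 T A x) * oscL2 T A x
        = oscL2 T A x ^ 2 / 16 := by field_simp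
    have k3 : 1 / (16 * T) * T = 1 / 16 := by field_simp
    rw [k3]
    have k4 : 0 < oscL2 T A x ^ 2 := by positivity
    linarith

end TestLoop

/-! ### Existence of minimisers among tame loops. -/

section Compactness

/-- The Arzelà–Ascoli theorem for equi-Lipschitz curves in a compact set. -/
theorem exists_subseq_tendsto_of_lipschitzWith {F : Type*} [MetricSpace F] {M : NNReal} {K : Set F}
    (hK : IsCompact K) {u : ℕ → ℝ → F} (hu : ∀ n, LipschitzWith M (u n)) (hm : ∀ n t, u n t ∈ K) :
    ∃ φ : ℕ → ℕ, StrictMono φ ∧ ∃ w : ℝ → F, LipschitzWith M w ∧ (∀ t, w t ∈ K) ∧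
      ∀ t, Tendsto (fun n => u (φ n) t) atTop (𝓝 (w t)) := by
  set B : Set C(ℝ, F) := {f | LipschitzWith M f ∧ ∀ t, f t ∈ K} with hB
  have himage : ContinuousMap.toFun '' B
      = {f : ℝ → F | LipschitzWith M f} ∩ Set.pi univ (fun _ => K) := by
    ext f
    constructor
    · rintro ⟨g, ⟨hg1, hg2⟩, rfl⟩
      exact ⟨hg1, fun t _ => hg2 t⟩
    · rintro ⟨hf1, hf2⟩
      exact ⟨⟨f, hf1.continuous⟩, ⟨hf1, fun t => hf2 t (mem_univ t)⟩, rfl⟩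
  have hclosed : IsClosed {f : ℝ → F | LipschitzWith M f} := by
    have : {f : ℝ → F | LipschitzWith M f}
        = ⋂ s, ⋂ t, {f : ℝ → F | dist (f s) (f t) ≤ M * dist s t} := by
      ext f
      simp [lipschitzWith_iff_dist_le_mul]
    rw [this]
    exact isClosed_iInter fun s => isClosed_iInter fun t =>
      isClosed_le ((continuous_apply s).dist (continuous_apply t)) continuous_const
  have hcomp : IsCompact B := by
    apply ArzelaAscoli.isCompact_of_equicontinuous
    · rw [himage]
      exact (isCompact_univ_pi fun _ => hK).inter_left hclosed
    · exact (LipschitzWith.uniformEquicontinuous _ M fun f => f.2.1).equicontinuous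
  obtain ⟨w, hw, φ, hφ, hlim⟩ := hcomp.isSeqCompact
    (x := fun n => (⟨u n, (hu n).continuous⟩ : C(ℝ, F))) (fun n => ⟨hu n, hm n⟩)
  exact ⟨φ, hφ, w, hw.1, hw.2, fun t =>
    ((ContinuousEvalConst.continuous_eval_const t).tendsto w).comp hlim⟩

/-- Loops in `N` with speed at most `k` and `M`-Lipschitz velocity. -/
structure IsTameLoop (T k : ℝ) (M : NNReal) (N : Set E3) (q v : ℝ → E3) : Prop
    extends IsLoop T q v where
  speed_le : ∀ t, ‖v t‖ ≤ k
  lipschitz : LipschitzWith M v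
  mem : ∀ t, q t ∈ N

variable {T k : ℝ} {M : NNReal} {N S : Set E3} {A : ℝ → E3 → E3} {Φ : ℝ → E3 → ℝ}

theorem IsLoop.lipschitzWith_one {q v : ℝ → E3} (h : IsLoop T q v) (hv : ∀ t, ‖v t‖ ≤ 1) :
    LipschitzWith 1 q :=
  LipschitzWith.of_dist_le_mul fun s t => by
    rw [dist_eq_norm, Real.dist_eq, NNReal.coe_one, one_mul]
    exact h.norm_sub_le hv t s

/-- Arzelà–Ascoli is applied to the positions and then to the velocities; the limit velocity is the
derivative of the limit position because `q t = q 0 + ∫ v` survives dominated convergence. -/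
theorem IsTameLoop.exists_subseq (hk : k ≤ 1) (hN : IsCompact N) {q v : ℕ → ℝ → E3}
    (h : ∀ n, IsTameLoop T k M N (q n) (v n)) :
    ∃ φ : ℕ → ℕ, StrictMono φ ∧ ∃ q' v', IsTameLoop T k M N q' v' ∧
      (∀ t, Tendsto (fun n => q (φ n) t) atTop (𝓝 (q' t))) ∧
      ∀ t, Tendsto (fun n => v (φ n) t) atTop (𝓝 (v' t)) := by
  have hv1 : ∀ n t, ‖v n t‖ ≤ 1 := fun n t => ((h n).speed_le t).trans hk
  obtain ⟨φ, hφ, q', -, hq'N, hq'⟩ := exists_subseq_tendsto_of_lipschitzWith hN (M := 1)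
    (u := q) (fun n => (h n).lipschitzWith_one (hv1 n)) fun n t => (h n).mem t
  obtain ⟨ψ, hψ, v', hv'M, hv'k, hv'⟩ := exists_subseq_tendsto_of_lipschitzWith
    (isCompact_closedBall (0 : E3) k) (u := fun n => v (φ n)) (fun n => (h (φ n)).lipschitz)
    fun n t => mem_closedBall_zero_iff.2 ((h (φ n)).speed_le t)
  have hq'' : ∀ t, Tendsto (fun n => q (φ (ψ n)) t) atTop (𝓝 (q' t)) := fun t =>
    (hq' t).comp hψ.tendsto_atTop
  refine ⟨φ ∘ ψ, hφ.comp hψ, q', v', ⟨⟨?_, hv'M.continuous, ?_⟩, ?_, hv'M, hq'N⟩, hq'', hv'⟩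
  · have e : q' = fun t => q' 0 + ∫ s in (0 : ℝ)..t, v' s := by
      ext1 t
      have l1 : Tendsto (fun n => ∫ s in (0 : ℝ)..t, v (φ (ψ n)) s) atTop
          (𝓝 (∫ s in (0 : ℝ)..t, v' s)) := by
        apply intervalIntegral.tendsto_integral_filter_of_dominated_convergence (fun _ => 1)
        · exact Eventually.of_forall fun n => (h _).continuous_velocity.aestronglyMeasurable
        · exact Eventually.of_forall fun n => Eventually.of_forall fun s _ => hv1 _ s
        · simp
        · exact Eventually.of_forall fun s _ => hv' s
      have l2 := (hq'' 0).add l1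
      have e2 : (fun n => q (φ (ψ n)) 0 + ∫ s in (0 : ℝ)..t, v (φ (ψ n)) s)
          = fun n => q (φ (ψ n)) t := by
        ext1 n
        rw [(h _).integral_velocity]
        abel
      rw [e2] at l2
      exact tendsto_nhds_unique (hq'' t) l2
    intro t
    rw [e]
    exact (intervalIntegral.integral_hasDerivAt_right (hv'M.continuous.intervalIntegrable _ _)
      hv'M.continuous.aestronglyMeasurable.stronglyMeasurableAtFilter
      hv'M.continuous.continuousAt).const_add _
  · intro t
    refine tendsto_nhds_unique (hq'' (t + T)) ?_
    simpa only [(h _).periodic] using hq'' t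
  · exact fun t => mem_closedBall_zero_iff.1 (hv'k t)

theorem IsAdmissible.tendsto_action (h : IsAdmissible T S A Φ) (hT : 0 < T) (hS : IsClosed S)
    (hk : k ≤ 1) (hN : IsCompact N) (hNS : ∀ x ∈ N, x ∉ S) {q v : ℕ → ℝ → E3} {q' v' : ℝ → E3}
    (hqv : ∀ n, IsTameLoop T k M N (q n) (v n)) (hqv' : IsTameLoop T k M N q' v')
    (hq : ∀ t, Tendsto (fun n => q n t) atTop (𝓝 (q' t)))
    (hv : ∀ t, Tendsto (fun n => v n t) atTop (𝓝 (v' t))) :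
    Tendsto (fun n => action T A Φ (q n) (v n)) atTop (𝓝 (action T A Φ q' v')) := by
  obtain ⟨C, hC⟩ := h.scalar.exists_bound hS hN hNS
  obtain ⟨D, hD⟩ := ((isCompact_Icc (a := 0) (b := T)).prod hN).exists_bound_of_continuousOn
    h.vector.contDiff.continuous.continuousOn
  apply intervalIntegral.tendsto_integral_filter_of_dominated_convergence (fun _ => 1 + D + C)
  · exact Eventually.of_forall fun n => (h.continuous_lagrangian hS (hqv n).toIsLoop
      fun t => hNS _ ((hqv n).mem t)).aestronglyMeasurable
  · refine Eventually.of_forall fun n => Eventually.of_forall fun t ht => ?_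
    rw [uIoc_of_le hT.le] at ht
    have ht' : t ∈ Icc 0 T := Ioc_subset_Icc_self ht
    have a1 := hC t ht' _ ((hqv n).mem t)
    have a2 : ‖A t (q n t)‖ ≤ D := hD (t, q n t) ⟨ht', (hqv n).mem t⟩
    have a3 : ‖inner ℝ (v n t) (A t (q n t))‖ ≤ 1 * D :=
      (norm_inner_le_norm _ _).trans
        (mul_le_mul (((hqv n).speed_le t).trans hk) a2 (norm_nonneg _) zero_le_one)
    have a4 : ‖1 - √(1 - ‖v n t‖ ^ 2)‖ ≤ 1 := by
      rw [Real.norm_of_nonneg kinetic_nonneg]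
      linarith [Real.sqrt_nonneg (1 - ‖v n t‖ ^ 2)]
    unfold lagrangian
    refine (norm_sub_le _ _).trans ?_
    linarith [norm_add_le (1 - √(1 - ‖v n t‖ ^ 2)) (inner ℝ (v n t) (A t (q n t)))]
  · simp
  · refine Eventually.of_forall fun t _ => ?_
    have c1 : Continuous (fun w : E3 => 1 - √(1 - ‖w‖ ^ 2)) := by fun_prop
    have c2 : Continuous (A t) := (differentiable_space h.vector.contDiff t).continuous
    have c3 : ContinuousAt (Φ t) (q' t) :=
      (h.scalar.differentiableAt hS t (hNS _ (hqv'.mem t))).continuousAt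
    exact (((c1.tendsto _).comp (hv t)).add ((hv t).inner ((c2.tendsto _).comp (hq t)))).sub
      (c3.tendsto.comp (hq t))

theorem IsAdmissible.exists_action_minimizer (h : IsAdmissible T S A Φ) (hT : 0 < T)
    (hS : IsClosed S) (hk : k ≤ 1) (hN : IsCompact N) (hNS : ∀ x ∈ N, x ∉ S)
    (hne : ∃ q v, IsTameLoop T k M N q v) :
    ∃ q v, IsTameLoop T k M N q v ∧
      ∀ q' v', IsTameLoop T k M N q' v' → action T A Φ q v ≤ action T A Φ q' v' := by
  set V : Set ℝ := {a | ∃ q v, IsTameLoop T k M N q v ∧ action T A Φ q v = a} with hV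
  have hcomp : IsCompact V := by
    apply IsSeqCompact.isCompact
    intro a ha
    choose q v hqv hact using ha
    obtain ⟨φ, hφ, q', v', hqv', hq, hv⟩ := IsTameLoop.exists_subseq hk hN hqv
    refine ⟨action T A Φ q' v', ⟨q', v', hqv', rfl⟩, φ, hφ, ?_⟩
    have := h.tendsto_action hT hS hk hN hNS (fun n => hqv (φ n)) hqv' hq hv
    simpa only [hact, Function.comp_def] using this
  obtain ⟨q₀, v₀, h₀⟩ := hne
  obtain ⟨a, ⟨q, v, hqv, rfl⟩, hle⟩ := hcomp.exists_isLeast ⟨_, q₀, v₀, h₀, rfl⟩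
  exact ⟨q, v, hqv, fun q' v' h' => hle ⟨q', v', h', rfl⟩⟩

end Compactness

/-! ### First variation and the variational inequality. -/

section FirstVariation

variable {T k : ℝ} {M : NNReal} {N S : Set E3} {A : ℝ → E3 → E3} {Φ : ℝ → E3 → ℝ}
  {q v h w r u : ℝ → E3}

theorem IsLoop.add_smul (hq : IsLoop T q v) (hh : IsLoop T h w) (s : ℝ) :
    IsLoop T (fun t => q t + s • h t) (fun t => v t + s • w t) where
  hasDerivAt t := (hq.hasDerivAt t).add ((hh.hasDerivAt t).const_smul s)
  continuous_velocity := hq.continuous_velocity.add (hh.continuous_velocity.const_smul s)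
  periodic t := by rw [hq.periodic, hh.periodic]

theorem IsLoop.sub (hq : IsLoop T q v) (hh : IsLoop T h w) :
    IsLoop T (fun t => q t - h t) (fun t => v t - w t) where
  hasDerivAt t := (hq.hasDerivAt t).sub (hh.hasDerivAt t)
  continuous_velocity := hq.continuous_velocity.sub hh.continuous_velocity
  periodic t := by rw [hq.periodic, hh.periodic]

theorem IsLoop.exists_perturbation_notMem (hT : 0 < T) (hS : IsClosed S) (hq : IsLoop T q v)
    (hqS : ∀ t, q t ∉ S) (hh : IsLoop T h w) :
    ∃ ε > 0, ∀ s ∈ Metric.closedBall (0 : ℝ) ε, ∀ t, q t + s • h t ∉ S := by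
  obtain ⟨δ, hδ, hsub⟩ := ((isCompact_Icc (a := 0) (b := T)).image
    hq.continuous).exists_thickening_subset_open hS.isOpen_compl
    (by rintro _ ⟨t, -, rfl⟩; exact hqS t)
  obtain ⟨H, hH⟩ := (isCompact_Icc (a := 0) (b := T)).exists_bound_of_continuousOn
    hh.continuous.continuousOn
  have hH0 : 0 ≤ H := (norm_nonneg _).trans (hH 0 ⟨le_rfl, hT.le⟩)
  refine ⟨δ / (H + 1), by positivity, fun s hs t => ?_⟩
  obtain ⟨t', ht', e⟩ := exists_mem_Icc_eq_of_periodic (f := fun t => q t + s • h t)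
    (hq.add_smul hh s).periodic hT t
  rw [← e]
  apply hsub
  rw [Metric.mem_thickening_iff]
  refine ⟨q t', mem_image_of_mem q ht', ?_⟩
  rw [mem_closedBall_zero_iff, Real.norm_eq_abs, le_div_iff₀ (by linarith)] at hs
  rw [dist_eq_norm, add_sub_cancel_left, norm_smul, Real.norm_eq_abs]
  by_cases h0 : s = 0
  · simpa [h0] using hδ
  · have h1 : |s| * ‖h t'‖ ≤ |s| * H := by gcongr; exact hH t' ht'
    have h2 : 0 < |s| := abs_pos.2 h0
    linarith

/-- The density of the first variation of the interaction part of the action. -/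
noncomputable def variationDensity (A : ℝ → E3 → E3) (Φ : ℝ → E3 → ℝ) (t : ℝ) (x v h w : E3) : ℝ :=
  inner ℝ w (A t x) + inner ℝ v (fderiv ℝ (A t) x h) - inner ℝ (gradient (Φ t) x) h

theorem IsAdmissible.hasDerivAt_interaction (ha : IsAdmissible T S A Φ) (hS : IsClosed S)
    {t s : ℝ} {x v h w : E3} (hx : x + s • h ∉ S) :
    HasDerivAt (fun s => inner ℝ (v + s • w) (A t (x + s • h)) - Φ t (x + s • h))
      (variationDensity A Φ t (x + s • h) (v + s • w) h w) s := by
  have d1 : ∀ y z : E3, HasDerivAt (fun s : ℝ => y + s • z) z s := fun y z => by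
    simpa using ((hasDerivAt_id s).smul_const z).const_add y
  have d2 : HasDerivAt (fun s => A t (x + s • h)) (fderiv ℝ (A t) (x + s • h) h) s :=
    ((differentiable_space ha.vector.contDiff t _).hasFDerivAt).comp_hasDerivAt s (d1 x h)
  have d3 : HasDerivAt (fun s => Φ t (x + s • h)) (fderiv ℝ (Φ t) (x + s • h) h) s :=
    ((ha.scalar.differentiableAt hS t hx).hasFDerivAt).comp_hasDerivAt s (d1 x h)
  have d4 := ((d1 v w).inner ℝ d2).sub d3
  refine d4.congr_deriv ?_
  rw [variationDensity, inner_gradient, add_comm (inner ℝ w _)]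

/-- Differentiation under the integral sign. The kinetic term is left out: it is handled by
convexity alone. -/
theorem IsAdmissible.hasDerivAt_integral_interaction (ha : IsAdmissible T S A Φ) (hT : 0 < T)
    (hS : IsClosed S) (hq : IsLoop T q v) (hqS : ∀ t, q t ∉ S) (hh : IsLoop T h w) :
    HasDerivAt (fun s : ℝ => ∫ t in (0 : ℝ)..T,
        (inner ℝ (v t + s • w t) (A t (q t + s • h t)) - Φ t (q t + s • h t)))
      (∫ t in (0 : ℝ)..T, variationDensity A Φ t (q t) (v t) (h t) (w t)) 0 := by
  obtain ⟨ε, hε, hout⟩ := hq.exists_perturbation_notMem hT hS hqS hh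
  have hcq := hq.continuous
  have hch := hh.continuous
  have hcv := hq.continuous_velocity
  have hcw := hh.continuous_velocity
  have hcA := ha.vector.contDiff.continuous
  have hcDA := continuous_fderiv_space ha.vector.contDiff
  have hpos : Continuous (fun p : ℝ × ℝ => (p.2, q p.2 + p.1 • h p.2)) := by fun_prop
  have hcont : ContinuousOn (fun p : ℝ × ℝ => variationDensity A Φ p.2 (q p.2 + p.1 • h p.2)
      (v p.2 + p.1 • w p.2) (h p.2) (w p.2)) (Metric.closedBall 0 ε ×ˢ univ) := by
    have c1 : Continuous (fun p : ℝ × ℝ => A p.2 (q p.2 + p.1 • h p.2)) := hcA.comp hpos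
    have c2 : Continuous (fun p : ℝ × ℝ => fderiv ℝ (A p.2) (q p.2 + p.1 • h p.2) (h p.2)) :=
      (hcDA.comp hpos).clm_apply (hch.comp continuous_snd)
    have c3 : ContinuousOn (fun p : ℝ × ℝ => gradient (Φ p.2) (q p.2 + p.1 • h p.2))
        (Metric.closedBall 0 ε ×ˢ univ) :=
      ha.scalar.continuousOn_gradient.comp hpos.continuousOn
        fun p hp => ⟨mem_univ _, hout p.1 hp.1 p.2⟩
    have c4 : Continuous (fun p : ℝ × ℝ => w p.2) := by fun_prop
    have c5 : Continuous (fun p : ℝ × ℝ => v p.2 + p.1 • w p.2) := by fun_prop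
    have c6 : Continuous (fun p : ℝ × ℝ => h p.2) := by fun_prop
    exact ((c4.inner c1).add (c5.inner c2)).continuousOn.sub (c3.inner c6.continuousOn)
  obtain ⟨C, hC⟩ := ((isCompact_closedBall (0 : ℝ) ε).prod
    (isCompact_Icc (a := 0) (b := T))).exists_bound_of_continuousOn
    (hcont.mono (prod_mono le_rfl (subset_univ _)))
  have hFc : ∀ s ∈ Metric.closedBall (0 : ℝ) ε, Continuous (fun t =>
      inner ℝ (v t + s • w t) (A t (q t + s • h t)) - Φ t (q t + s • h t)) := by
    intro s hs
    have hl := hq.add_smul hh s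
    exact (hl.continuous_velocity.inner (hcA.comp (continuous_id.prodMk hl.continuous))).sub
      (ha.scalar.continuous_along hS hl.continuous (hout s hs))
  have h0m : (0 : ℝ) ∈ Metric.closedBall (0 : ℝ) ε := Metric.mem_closedBall_self hε.le
  have hF0 : Continuous (fun t => variationDensity A Φ t (q t + (0 : ℝ) • h t)
      (v t + (0 : ℝ) • w t) (h t) (w t)) :=
    hcont.comp_continuous (f := fun t => ((0 : ℝ), t)) (by fun_prop) fun t => ⟨h0m, mem_univ _⟩
  have key := (intervalIntegral.hasDerivAt_integral_of_dominated_loc_of_deriv_le (μ := volume)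
    (F := fun s t => inner ℝ (v t + s • w t) (A t (q t + s • h t)) - Φ t (q t + s • h t))
    (F' := fun s t => variationDensity A Φ t (q t + s • h t) (v t + s • w t) (h t) (w t))
    (bound := fun _ => C) (a := 0) (b := T)
    (Metric.closedBall_mem_nhds (0 : ℝ) hε)
    (by filter_upwards [Metric.closedBall_mem_nhds (0 : ℝ) hε] with s hs
        exact (hFc s hs).aestronglyMeasurable)
    ((hFc 0 h0m).intervalIntegrable _ _) hF0.aestronglyMeasurable
    (Eventually.of_forall fun t ht s hs => hC (s, t) ⟨hs, by
      rw [uIoc_of_le hT.le] at ht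
      exact Ioc_subset_Icc_self ht⟩)
    (by simp)
    (Eventually.of_forall fun t _ s hs => ha.hasDerivAt_interaction hS (hout s hs t))).2
  simpa using key

theorem lipschitzWith_combination {V : Type*} [NormedAddCommGroup V] [NormedSpace ℝ V]
    {v u : ℝ → V} (hv : LipschitzWith M v) (hu : LipschitzWith M u) {s : ℝ} (h0 : 0 ≤ s)
    (h1 : s ≤ 1) : LipschitzWith M (fun t => v t + s • (u t - v t)) := by
  apply LipschitzWith.of_dist_le_mul
  intro x y
  have e : v x + s • (u x - v x) - (v y + s • (u y - v y))
      = (1 - s) • (v x - v y) + s • (u x - u y) := by module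
  have a1 := hv.dist_le_mul x y
  have a2 := hu.dist_le_mul x y
  rw [dist_eq_norm] at a1 a2 ⊢
  rw [e]
  refine (norm_add_le _ _).trans ?_
  rw [norm_smul, norm_smul, Real.norm_of_nonneg h0, Real.norm_of_nonneg (by linarith)]
  have b1 := mul_le_mul_of_nonneg_left a1 (show 0 ≤ 1 - s by linarith)
  have b2 := mul_le_mul_of_nonneg_left a2 h0
  linarith

/-- The variational inequality satisfied by a minimiser of the action among tame loops. -/
theorem IsAdmissible.variational_inequality (ha : IsAdmissible T S A Φ) (hT : 0 < T)
    (hS : IsClosed S) (hk : k < 1) (hNS : ∀ x ∈ N, x ∉ S) {c : ℝ}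
    (hconf : ∀ q v : ℝ → E3, IsLoop T q v → (∀ t, ‖v t‖ ≤ 1) → (∀ t, q t ∉ S) →
      action T A Φ q v ≤ -c → ∀ t, q t ∈ N)
    (hq : IsTameLoop T k M N q v) (hqc : action T A Φ q v ≤ -c)
    (hmin : ∀ q' v', IsTameLoop T k M N q' v' → action T A Φ q v ≤ action T A Φ q' v')
    (hr : IsLoop T r u) (huk : ∀ t, ‖u t‖ ≤ k) (huM : LipschitzWith M u) :
    0 ≤ (∫ t in (0 : ℝ)..T, (√(1 - ‖v t‖ ^ 2) - √(1 - ‖u t‖ ^ 2))) +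
      ∫ t in (0 : ℝ)..T, variationDensity A Φ t (q t) (v t) (r t - q t) (u t - v t) := by
  have hqS : ∀ t, q t ∉ S := fun t => hNS _ (hq.mem t)
  have hh := hr.sub hq.toIsLoop
  have hcv := hq.continuous_velocity
  have hcu := hr.continuous_velocity
  have hL := ha.hasDerivAt_integral_interaction hT hS hq.toIsLoop hqS hh
  set L : ℝ → ℝ := fun s => ∫ t in (0 : ℝ)..T,
    (inner ℝ (v t + s • (u t - v t)) (A t (q t + s • (r t - q t)))
      - Φ t (q t + s • (r t - q t))) with hLdef
  obtain ⟨ε, hε, hout⟩ := hq.toIsLoop.exists_perturbation_notMem hT hS hqS hh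
  set a := ∫ t in (0 : ℝ)..T, (√(1 - ‖v t‖ ^ 2) - √(1 - ‖u t‖ ^ 2)) with hadef
  have hcint : ∀ s ∈ Metric.closedBall (0 : ℝ) ε, IntervalIntegrable (fun t =>
      inner ℝ (v t + s • (u t - v t)) (A t (q t + s • (r t - q t)))
        - Φ t (q t + s • (r t - q t))) volume 0 T := by
    intro s hs
    have hl := hq.toIsLoop.add_smul hh s
    exact ((hl.continuous_velocity.inner (ha.vector.contDiff.continuous.comp
      (continuous_id.prodMk hl.continuous))).sub
      (ha.scalar.continuous_along hS hl.continuous (hout s hs))).intervalIntegrable _ _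
  have hact : ∀ s ∈ Metric.closedBall (0 : ℝ) ε,
      action T A Φ (fun t => q t + s • (r t - q t)) (fun t => v t + s • (u t - v t))
        = (∫ t in (0 : ℝ)..T, (1 - √(1 - ‖v t + s • (u t - v t)‖ ^ 2))) + L s := by
    intro s hs
    rw [hLdef, ← intervalIntegral.integral_add (Continuous.intervalIntegrable (by fun_prop) _ _)
      (hcint s hs)]
    simp only [action, lagrangian, add_sub_assoc]
  have hineq : ∀ s, 0 < s → s < 1 → s ≤ ε → 0 ≤ s * a + (L s - L 0) := by
    intro s hs0 hs1 hsε
    have hs : s ∈ Metric.closedBall (0 : ℝ) ε := by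
      rwa [mem_closedBall_zero_iff, Real.norm_of_nonneg hs0.le]
    have h0 : (0 : ℝ) ∈ Metric.closedBall (0 : ℝ) ε := Metric.mem_closedBall_self hε.le
    have hl := hq.toIsLoop.add_smul hh s
    have hlk : ∀ t, ‖v t + s • (u t - v t)‖ ≤ k := by
      intro t
      have e : v t + s • (u t - v t) = (1 - s) • v t + s • u t := by module
      rw [e]
      refine (norm_add_le _ _).trans ?_
      rw [norm_smul, norm_smul, Real.norm_of_nonneg hs0.le, Real.norm_of_nonneg (by linarith)]
      have b1 := mul_le_mul_of_nonneg_left (hq.speed_le t) (show 0 ≤ 1 - s by linarith)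
      have b2 := mul_le_mul_of_nonneg_left (huk t) hs0.le
      linarith
    have hle : action T A Φ q v ≤
        action T A Φ (fun t => q t + s • (r t - q t)) (fun t => v t + s • (u t - v t)) := by
      -- A competitor below the minimum also lies below `-c`, so confinement puts it in `N`; it is
      -- then tame and contradicts minimality. Hence the constraint `N` is never active.
      by_contra! hlt
      have hmem := hconf _ _ hl (fun t => (hlk t).trans hk.le) (hout s hs) (hlt.le.trans hqc)
      exact hlt.not_ge (hmin _ _ ⟨hl, hlk, lipschitzWith_combination hq.lipschitz huM hs0.le hs1.le, hmem⟩)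
    have hq0 := hact 0 h0
    simp only [zero_smul, add_zero] at hq0
    rw [hact s hs, hq0] at hle
    have hkin : ∫ t in (0 : ℝ)..T, (1 - √(1 - ‖v t + s • (u t - v t)‖ ^ 2)) ≤
        (∫ t in (0 : ℝ)..T, (1 - √(1 - ‖v t‖ ^ 2))) + s * a := by
      rw [hadef, ← intervalIntegral.integral_const_mul, ← intervalIntegral.integral_add]
      · apply intervalIntegral.integral_mono_on hT.le
        · exact Continuous.intervalIntegrable (by fun_prop) _ _
        · exact Continuous.intervalIntegrable (by fun_prop) _ _
        · intro t _
          have := le_sqrt_one_sub_norm_sq_combination ((hq.speed_le t).trans_lt hk)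
            ((huk t).trans hk.le) hs0.le hs1
          linarith
      all_goals exact Continuous.intervalIntegrable (by fun_prop) _ _
    linarith
  -- Dividing by `s` and letting `s → 0+` turns the finite inequality into the variational one.
  have hslope := hL.tendsto_slope_zero_right
  have hlim := hslope.const_add a
  refine ge_of_tendsto hlim ?_
  filter_upwards [Ioo_mem_nhdsGT (lt_min one_pos hε)] with s hs
  have h1 := hineq s hs.1 (hs.2.trans_le (min_le_left _ _)) (hs.2.le.trans (min_le_right _ _))
  have h2 : a + s⁻¹ • (L (0 + s) - L 0) = s⁻¹ * (s * a + (L s - L 0)) := by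
    have := hs.1.ne'
    rw [zero_add, smul_eq_mul]
    field_simp
  rw [h2]
  exact mul_nonneg (inv_nonneg.2 hs.1.le) h1

end FirstVariation

/-! ### From the variational inequality to the Lorentz equation. -/

section EulerLagrange

variable {T k : ℝ} {M : NNReal} {N S : Set E3} {A : ℝ → E3 → E3} {Φ : ℝ → E3 → ℝ}
  {q v : ℝ → E3}

theorem adjoint_apply_coord (L : E3 →L[ℝ] E3) (v : E3) (i : Fin 3) :
    ContinuousLinearMap.adjoint L v i = ∑ j, v j * L (EuclideanSpace.single i 1) j := by
  have h1 : ContinuousLinearMap.adjoint L v i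
      = inner ℝ (EuclideanSpace.single i (1 : ℝ)) (ContinuousLinearMap.adjoint L v) := by
    rw [EuclideanSpace.inner_single_left]; simp
  rw [h1, ContinuousLinearMap.adjoint_inner_right, PiLp.inner_apply]
  simp

theorem apply_coord (L : E3 →L[ℝ] E3) (v : E3) (i : Fin 3) :
    L v i = ∑ j, v j * L (EuclideanSpace.single j 1) i := by
  have h1 : v = ∑ j, v j • EuclideanSpace.single j (1 : ℝ) := by
    ext i
    simp [Finset.sum_apply, Pi.single_apply]
  conv_lhs => rw [h1]
  simp [map_sum]

/-- The magnetic force is the antisymmetric part of the derivative of the vector potential. -/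
theorem cross_curl (F : E3 → E3) (x v : E3) :
    cross v (curl F x) = ContinuousLinearMap.adjoint (fderiv ℝ F x) v - fderiv ℝ F x v := by
  ext i
  rw [PiLp.sub_apply, adjoint_apply_coord, apply_coord]
  fin_cases i <;> simp [cross, curl, partialD, cross_apply, Fin.sum_univ_three] <;> ring

theorem IsLoop.speed_lt_one (hq : IsLoop T q v) (hk : k < 1) (hv : ∀ t, ‖v t‖ ≤ k) :
    supNorm (deriv q) < 1 := by
  have : supNorm (deriv q) ≤ ENNReal.ofReal k := by
    refine iSup_le fun t => ?_
    rw [(hq.hasDerivAt t).deriv, ← ofReal_norm]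
    exact ENNReal.ofReal_le_ofReal (hv t)
  refine this.trans_lt ?_
  rw [ENNReal.ofReal_lt_one]
  exact hk

/-- The generalised force derived from the potentials, apart from the inertial term. -/
noncomputable def generalizedForce (A : ℝ → E3 → E3) (Φ : ℝ → E3 → ℝ) (q v : ℝ → E3) (t : ℝ) : E3 :=
  ContinuousLinearMap.adjoint (fderiv ℝ (A t) (q t)) (v t) - gradient (Φ t) (q t)

theorem IsAdmissible.continuous_generalizedForce (ha : IsAdmissible T S A Φ) (hS : IsClosed S)
    (hq : IsLoop T q v) (hqS : ∀ t, q t ∉ S) : Continuous (generalizedForce A Φ q v) := by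
  have c1 : Continuous (fun t => ContinuousLinearMap.adjoint (fderiv ℝ (A t) (q t))) :=
    (ContinuousLinearMap.adjoint (𝕜 := ℝ) (E := E3) (F := E3)).continuous.comp
      ((continuous_fderiv_space ha.vector.contDiff).comp (continuous_id.prodMk hq.continuous))
  exact (c1.clm_apply hq.continuous_velocity).sub
    (ha.scalar.continuous_gradient_along hS hq.continuous hqS)

theorem IsAdmissible.generalizedForce_periodic (ha : IsAdmissible T S A Φ) (hS : IsClosed S)
    (hq : IsLoop T q v) (hqS : ∀ t, q t ∉ S) (t : ℝ) :
    generalizedForce A Φ q v (t + T) = generalizedForce A Φ q v t := by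
  rw [generalizedForce, generalizedForce, hq.periodic, hq.velocity_periodic,
    ha.vector.fderiv_periodic, ha.scalar.gradient_periodic hS t (hqS t)]

theorem variationDensity_eq (t : ℝ) (h w : E3) :
    variationDensity A Φ t (q t) (v t) h w
      = inner ℝ w (A t (q t)) + inner ℝ (generalizedForce A Φ q v t) h := by
  rw [variationDensity, generalizedForce, inner_sub_left, ContinuousLinearMap.adjoint_inner_left]
  ring

/-- A loop whose momentum is a primitive of the Lorentz force solves the Lorentz force equation. -/
theorem IsAdmissible.isPeriodicSolution (ha : IsAdmissible T S A Φ) (hS : IsClosed S)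
    (hq : IsLoop T q v) (hqS : ∀ t, q t ∉ S) (hk : k < 1) (hv : ∀ t, ‖v t‖ ≤ k) {p : ℝ → E3}
    (hp : ∀ t, HasDerivAt p (generalizedForce A Φ q v t
      - (timeDeriv A t (q t) + fderiv ℝ (A t) (q t) (v t))) t)
    (hpv : ∀ t, v t = relVelocity (p t)) : IsPeriodicSolution T S A Φ q where
  notMem := hqS
  periodic := hq.periodic
  speed_lt := hq.speed_lt_one hk hv
  contDiff := by
    have hdq : deriv q = v := funext fun t => (hq.hasDerivAt t).deriv
    have hdp : deriv p = fun t => generalizedForce A Φ q v t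
      - (timeDeriv A t (q t) + fderiv ℝ (A t) (q t) (v t)) := funext fun t => (hp t).deriv
    have hp1 : ContDiff ℝ 1 p := by
      rw [contDiff_one_iff_deriv, hdp]
      refine ⟨fun t => (hp t).differentiableAt, ?_⟩
      have c0 : Continuous fun t => (t, q t) := continuous_id.prodMk hq.continuous
      exact (ha.continuous_generalizedForce hS hq hqS).sub
        (((continuous_timeDeriv ha.vector.contDiff).comp c0).add
          (((continuous_fderiv_space ha.vector.contDiff).comp c0).clm_apply hq.continuous_velocity))
    have hv1 : ContDiff ℝ 1 v := by
      rw [funext hpv]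
      exact contDiff_relVelocity.comp hp1
    rw [show (2 : WithTop ℕ∞) = 1 + 1 by norm_num, contDiff_succ_iff_deriv, hdq]
    exact ⟨fun t => (hq.hasDerivAt t).differentiableAt, by simp, hv1⟩
  equation t := by
    have e1 : (fun s => (1 / √(1 - ‖deriv q s‖ ^ 2)) • deriv q s) = p := by
      ext1 s
      rw [(hq.hasDerivAt s).deriv, hpv, momentum_relVelocity]
    rw [e1, (hq.hasDerivAt t).deriv]
    refine (hp t).congr_deriv ?_
    rw [magnetic, cross_curl, electric, generalizedForce]
    abel

/-- Integration by parts without boundary terms. It moves the force onto the velocity variation,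
leaving a problem in the velocities alone. -/
theorem IsLoop.integral_inner_eq_neg {G g h w : ℝ → E3} (hh : IsLoop T h w) (hg : Continuous g)
    (hG : ∀ t, HasDerivAt G (g t) t) (hG0 : G 0 = 0) (hGT : G T = 0) :
    ∫ t in (0 : ℝ)..T, inner ℝ (g t) (h t) = -∫ t in (0 : ℝ)..T, inner ℝ (G t) (w t) := by
  have hcG : Continuous G := continuous_iff_continuousAt.2 fun t => (hG t).continuousAt
  have hch := hh.continuous
  have hcw := hh.continuous_velocity
  have key := intervalIntegral.integral_eq_sub_of_hasDerivAt (a := 0) (b := T)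
    (f := fun t => inner ℝ (G t) (h t))
    (f' := fun t => inner ℝ (G t) (w t) + inner ℝ (g t) (h t))
    (fun t _ => (hG t).inner ℝ (hh.hasDerivAt t))
    (Continuous.intervalIntegrable (by fun_prop) _ _)
  rw [intervalIntegral.integral_add (Continuous.intervalIntegrable (by fun_prop) _ _)
    (Continuous.intervalIntegrable (by fun_prop) _ _), hG0, hGT, inner_zero_left,
    inner_zero_left, sub_zero] at key
  linarith

/-- A velocity that solves the convex minimisation problem with linear term `W` is the
relativistic velocity of a translate of `-W`. -/
theorem eq_relVelocity_of_variational_inequality (hT : 0 < T) {v W : ℝ → E3} {l : E3}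
    (hv : Continuous v) (hW : Continuous W) (hvp : ∀ t, v (t + T) = v t)
    (hWp : ∀ t, W (t + T) = W t) (hv1 : ∀ t, ‖v t‖ ≤ 1)
    (hv0 : ∫ t in (0 : ℝ)..T, v t = 0)
    (hl : ∫ t in (0 : ℝ)..T, relVelocity (l - W t) = 0)
    (hineq : 0 ≤ ∫ t in (0 : ℝ)..T, ((√(1 - ‖v t‖ ^ 2) - √(1 - ‖relVelocity (l - W t)‖ ^ 2))
      + inner ℝ (relVelocity (l - W t) - v t) (W t))) (t : ℝ) :
    v t = relVelocity (l - W t) := by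
  have hu : Continuous (fun t => relVelocity (l - W t)) :=
    continuous_relVelocity.comp (by fun_prop)
  -- Fenchel with remainder at the momentum `l - W t`, where the competitor attains equality. The
  -- term in `l` integrates to zero since both velocities have mean zero, so the squared distance
  -- has nonpositive integral.
  have hpt : ∀ t ∈ Icc 0 T, 1 / 2 * ‖v t - relVelocity (l - W t)‖ ^ 2 ≤
      inner ℝ l (relVelocity (l - W t) - v t) - ((√(1 - ‖v t‖ ^ 2)
        - √(1 - ‖relVelocity (l - W t)‖ ^ 2)) + inner ℝ (relVelocity (l - W t) - v t) (W t)) := by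
    intro t _
    have h1 := inner_add_sqrt_add_sq_le (l - W t) (v t) (hv1 t)
    have h2 := inner_relVelocity_add_sqrt (l - W t)
    rw [real_inner_comm]
    simp only [inner_sub_left] at h1 h2 ⊢
    rw [real_inner_comm (W t) (v t), real_inner_comm (W t) (relVelocity (l - W t)),
      real_inner_comm l (v t), real_inner_comm l (relVelocity (l - W t))]
    linarith [real_inner_comm l (v t)]
  have c1 : Continuous fun t => 1 / 2 * ‖v t - relVelocity (l - W t)‖ ^ 2 := by fun_prop
  have c2 : Continuous fun t => relVelocity (l - W t) - v t := hu.sub hv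
  have c3 : Continuous fun t => inner ℝ l (relVelocity (l - W t) - v t) := by fun_prop
  have c4 : Continuous fun t => (√(1 - ‖v t‖ ^ 2) - √(1 - ‖relVelocity (l - W t)‖ ^ 2))
      + inner ℝ (relVelocity (l - W t) - v t) (W t) := by fun_prop
  have i3 := c3.intervalIntegrable (μ := volume) 0 T
  have i4 := c4.intervalIntegrable (μ := volume) 0 T
  have hmono := intervalIntegral.integral_mono_on hT.le (c1.intervalIntegrable _ _) (i3.sub i4) hpt
  rw [intervalIntegral.integral_const_mul, intervalIntegral.integral_sub i3 i4,
    intervalIntegral_inner c2,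
    intervalIntegral.integral_sub (hu.intervalIntegrable _ _) (hv.intervalIntegrable _ _), hl, hv0,
    sub_zero, inner_zero_right, zero_sub] at hmono
  have := eq_zero_of_integral_norm_sq_nonpos hT (f := fun t => v t - relVelocity (l - W t))
    (hv.sub hu) (fun t => by simp only [hvp, hWp]) (by linarith) t
  exact sub_eq_zero.1 this

/-- One `B T` bounds the momentum at time zero, by mean zero of the velocity; the other bounds its
change over a period. This a priori bound is what makes the speed cap `k` harmless. -/
theorem norm_sub_translate_le (hT : 0 < T) {W : ℝ → E3} {B : ℝ}
    (hWB : ∀ s t, ‖W t - W s‖ ≤ B * |t - s|) (hWp : ∀ t, W (t + T) = W t) {l : E3}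
    (hl : ∫ t in (0 : ℝ)..T, relVelocity (l - W t) = 0) (t : ℝ) : ‖l - W t‖ ≤ 2 * B * T := by
  have hB0 : 0 ≤ B := by simpa using (norm_nonneg _).trans (hWB 0 1)
  have hW : Continuous W := by
    have : LipschitzWith ⟨B, hB0⟩ W := LipschitzWith.of_dist_le_mul fun s t => by
      rw [dist_eq_norm, Real.dist_eq]; exact hWB t s
    exact this.continuous
  have hosc : ∀ t ∈ Icc 0 T, ‖W t - W 0‖ ≤ B * T := fun t ht => by
    refine (hWB 0 t).trans ?_
    rw [sub_zero, abs_of_nonneg ht.1]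
    gcongr
    exact ht.2
  have h0 : ‖l - W 0‖ ≤ B * T :=
    norm_le_of_integral_relVelocity_eq_zero hT (p := fun t => l - W t) (by fun_prop)
      (fun t ht => by
        rw [sub_sub_sub_cancel_left, norm_sub_rev]
        exact hosc t ht) hl
  obtain ⟨s, hs, e⟩ := exists_mem_Icc_eq_of_periodic hWp hT t
  rw [← e]
  have e1 : l - W s = (l - W 0) - (W s - W 0) := by abel
  rw [e1]
  linarith [norm_sub_le (l - W 0) (W s - W 0), hosc s hs]

theorem norm_adjoint_apply_le {L : E3 →L[ℝ] E3} {C : ℝ} (hL : ‖L‖ ≤ C) {v : E3} (hv : ‖v‖ ≤ 1) :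
    ‖ContinuousLinearMap.adjoint L v‖ ≤ C := by
  refine (ContinuousLinearMap.le_opNorm _ _).trans ?_
  rw [LinearIsometryEquiv.norm_map]
  exact (mul_le_of_le_one_right (norm_nonneg _) hv).trans hL

theorem norm_apply_le {L : E3 →L[ℝ] E3} {C : ℝ} (hL : ‖L‖ ≤ C) {v : E3} (hv : ‖v‖ ≤ 1) :
    ‖L v‖ ≤ C :=
  (L.le_opNorm v).trans ((mul_le_of_le_one_right (norm_nonneg _) hv).trans hL)

/-- A minimiser of the action among tame loops solves the Lorentz force equation. -/
theorem IsAdmissible.isPeriodicSolution_of_minimizer (ha : IsAdmissible T S A Φ) (hT : 0 < T)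
    (hS : IsClosed S) (hk : k < 1) (hNS : ∀ x ∈ N, x ∉ S) {c : ℝ}
    (hconf : ∀ q v : ℝ → E3, IsLoop T q v → (∀ t, ‖v t‖ ≤ 1) → (∀ t, q t ∉ S) →
      action T A Φ q v ≤ -c → ∀ t, q t ∈ N)
    (hq : IsTameLoop T k M N q v) (hqc : action T A Φ q v ≤ -c)
    (hmin : ∀ q' v', IsTameLoop T k M N q' v' → action T A Φ q v ≤ action T A Φ q' v')
    {C D : ℝ} (hC : ∀ t x, ‖timeDeriv A t x‖ ≤ C ∧ ‖fderiv ℝ (A t) x‖ ≤ C)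
    (hD : ∀ t, ∀ x ∈ N, ‖gradient (Φ t) x‖ ≤ D)
    (hkY : 2 * (3 * C + D) * T / √(1 + (2 * (3 * C + D) * T) ^ 2) ≤ k)
    (hM : 3 * C + D ≤ M) : IsPeriodicSolution T S A Φ q := by
  have hqS : ∀ t, q t ∉ S := fun t => hNS _ (hq.mem t)
  have hv1 : ∀ t, ‖v t‖ ≤ 1 := fun t => (hq.speed_le t).trans hk.le
  have hcv := hq.continuous_velocity
  have hcq := hq.continuous
  set g := generalizedForce A Φ q v with hg
  have hgc : Continuous g := ha.continuous_generalizedForce hS hq.toIsLoop hqS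
  have hVI := fun r u hr huk huM => ha.variational_inequality hT hS hk hNS hconf hq hqc hmin
    (r := r) (u := u) hr huk huM
  -- Rigid translation of the loop by `-d` leaves the velocity unchanged, so the inequality reduces
  -- to `0 ≤ -‖d‖²`. Thus the primitive `G` of the force is periodic.
  have hg0 : ∫ t in (0 : ℝ)..T, g t = 0 := by
    set d := ∫ t in (0 : ℝ)..T, g t with hd
    have hr : IsLoop T (fun t => q t - d) v :=
      ⟨fun t => (hq.hasDerivAt t).sub_const d, hcv, fun t => by rw [hq.periodic]⟩
    have h1 := hVI _ v hr hq.speed_le hq.lipschitz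
    simp only [variationDensity_eq, sub_self, intervalIntegral.integral_zero, zero_add,
      inner_zero_left, sub_sub_cancel_left, inner_neg_right, intervalIntegral.integral_neg] at h1
    simp only [real_inner_comm d] at h1
    rw [intervalIntegral_inner hgc, ← hd, real_inner_self_eq_norm_sq] at h1
    have h2 : ‖d‖ = 0 := pow_eq_zero_iff two_ne_zero |>.1
      (le_antisymm (by linarith) (sq_nonneg _))
    exact norm_eq_zero.1 h2
  have hGloop : IsLoop T (fun t => (0 : E3) + ∫ s in (0 : ℝ)..t, g s) g :=
    isLoop_integral hgc (ha.generalizedForce_periodic hS hq.toIsLoop hqS) hg0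
  set G : ℝ → E3 := fun t => (0 : E3) + ∫ s in (0 : ℝ)..t, g s with hGdef
  have hG0 : G 0 = 0 := by simp [hGdef]
  have hGT : G T = 0 := by simp [hGdef, hg0]
  set W : ℝ → E3 := fun t => A t (q t) - G t with hWdef
  have hWd : ∀ t, HasDerivAt W (timeDeriv A t (q t) + fderiv ℝ (A t) (q t) (v t) - g t) t :=
    fun t => (hasDerivAt_along ha.vector.contDiff (hq.hasDerivAt t)).sub (hGloop.hasDerivAt t)
  have hWc : Continuous W := continuous_iff_continuousAt.2 fun t => (hWd t).continuousAt
  have hWp : ∀ t, W (t + T) = W t := fun t => by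
    simp only [hWdef]
    rw [hq.periodic, ha.vector.periodic, hGloop.periodic]
  -- The three `C` bound `∂ₜA`, the derivative of `A` along `v` and its adjoint; `D` bounds `∇Φ` on
  -- `N`.
  have hWB : ∀ s t, ‖W t - W s‖ ≤ (3 * C + D) * |t - s| := by
    intro s t
    have := convex_univ.norm_image_sub_le_of_norm_hasDerivWithin_le (f := W) (C := 3 * C + D)
      (fun t _ => (hWd t).hasDerivWithinAt) (fun t _ => ?_) (mem_univ s) (mem_univ t)
    · simpa using this
    · have b1 := (hC t (q t)).1
      have b2 := norm_apply_le (hC t (q t)).2 (hv1 t)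
      have b3 := norm_adjoint_apply_le (hC t (q t)).2 (hv1 t)
      have b4 := hD t (q t) (hq.mem t)
      have b5 : ‖g t‖ ≤ C + D := (norm_sub_le _ _).trans (add_le_add b3 b4)
      refine (norm_sub_le _ _).trans ?_
      linarith [norm_add_le (timeDeriv A t (q t)) (fderiv ℝ (A t) (q t) (v t))]
  -- The candidate `u` solves the convex problem without constraints. By `hkY` and `hM` it obeys the
  -- speed and Lipschitz bounds anyway, so it may be tested against `v`.
  obtain ⟨l, hl⟩ := exists_integral_relVelocity_eq_zero hT hWc
  set u : ℝ → E3 := fun t => relVelocity (l - W t) with hu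
  have huc : Continuous u := continuous_relVelocity.comp (by fun_prop)
  have huk : ∀ t, ‖u t‖ ≤ k := fun t =>
    (norm_relVelocity_le (norm_sub_translate_le hT hWB hWp hl t)).trans hkY
  have huM : LipschitzWith M u := LipschitzWith.of_dist_le_mul fun s t => by
    rw [dist_eq_norm, Real.dist_eq]
    refine (norm_relVelocity_sub_le _ _).trans ?_
    rw [sub_sub_sub_cancel_left, norm_sub_rev]
    refine (hWB t s).trans ?_
    gcongr
  have hr : IsLoop T (fun t => (0 : E3) + ∫ s in (0 : ℝ)..t, u s) u :=
    isLoop_integral huc (fun t => by simp only [hu, hWp]) hl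
  have hVIu := hVI _ u hr huk huM
  have hh := hr.sub hq.toIsLoop
  have hparts := hh.integral_inner_eq_neg hgc hGloop.hasDerivAt hG0 hGT
  have hch := hh.continuous
  have hcG := hGloop.continuous
  have hcA : Continuous (fun t => A t (q t)) :=
    ha.vector.contDiff.continuous.comp (continuous_id.prodMk hcq)
  have c1 : Continuous fun t => inner ℝ (u t - v t) (A t (q t)) := (huc.sub hcv).inner hcA
  have c2 : Continuous fun t => inner ℝ (g t) ((0 + ∫ s in (0 : ℝ)..t, u s) - q t) := hgc.inner hch
  have c3 : Continuous fun t => inner ℝ (G t) (u t - v t) := hcG.inner (huc.sub hcv)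
  have c5 : Continuous fun t => inner ℝ (u t - v t) (A t (q t)) - inner ℝ (G t) (u t - v t) :=
    c1.sub c3
  have c4 : Continuous fun t => √(1 - ‖v t‖ ^ 2) - √(1 - ‖u t‖ ^ 2) := by fun_prop
  simp only [variationDensity_eq, ← hg] at hVIu
  rw [intervalIntegral.integral_add (c1.intervalIntegrable _ _) (c2.intervalIntegrable _ _),
    hparts, ← sub_eq_add_neg, ← intervalIntegral.integral_sub (c1.intervalIntegrable _ _)
    (c3.intervalIntegrable _ _), ← intervalIntegral.integral_add (c4.intervalIntegrable _ _)
    (c5.intervalIntegrable _ _)] at hVIu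
  have hvu : ∀ t, v t = u t := eq_relVelocity_of_variational_inequality hT hcv hWc
    hq.velocity_periodic hWp hv1 hq.integral_velocity_period hl (by
      refine hVIu.trans_eq (intervalIntegral.integral_congr fun t _ => ?_)
      change _ = _ + inner ℝ (u t - v t) (A t (q t) - G t)
      rw [inner_sub_right (u t - v t), real_inner_comm (u t - v t) (G t)])
  refine ha.isPeriodicSolution hS hq.toIsLoop hqS hk hq.speed_le (p := fun t => l - W t)
    (fun t => ?_) hvu
  refine ((hWd t).const_sub l).congr_deriv ?_
  rw [neg_sub]

end EulerLagrange

/-! ### The nonconstant solution and the uniform speed bound. -/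

section Main

variable {T : ℝ} {S : Set E3} {A : ℝ → E3 → E3} {Φ : ℝ → E3 → ℝ}

theorem IsAdmissible.exists_nonconstant_solution (ha : IsAdmissible T S A Φ) (hT : 0 < T)
    (hS : IsCompact S) (hφ : ∀ x ∉ S, phiMean T Φ x ≤ 0)
    {q₀ v₀ : ℝ → E3} {M₀ : NNReal} (h₀ : IsLoop T q₀ v₀) (hv₀ : ∀ t, ‖v₀ t‖ ≤ 1 / 2)
    (hM₀ : LipschitzWith M₀ v₀) (hq₀S : ∀ t, q₀ t ∉ S) (hact : action T A Φ q₀ v₀ < 0) :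
    ∃ q : ℝ → E3, IsPeriodicSolution T S A Φ q ∧ ¬ ∃ c : E3, ∀ t, q t = c := by
  set c := -action T A Φ q₀ v₀ with hc
  obtain ⟨N, hN, hNS, hconf⟩ := ha.exists_compact_confinement hT hS hφ (c := c) (by linarith)
  obtain ⟨C, hC0, hC⟩ := ha.vector.exists_bound hT
  obtain ⟨D, hD0, hD⟩ := ha.scalar.exists_gradient_bound hT hS.isClosed hN hNS
  set Y := 2 * (3 * C + D) * T with hY
  set k := max (1 / 2) (Y / √(1 + Y ^ 2)) with hk
  have hk1 : k < 1 := max_lt (by norm_num) (relVelocity_bound_lt_one Y)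
  set M : NNReal := max M₀ (3 * C + D).toNNReal with hM
  have htame : IsTameLoop T k M N q₀ v₀ :=
    ⟨h₀, fun t => (hv₀ t).trans (le_max_left _ _), hM₀.weaken (le_max_left _ _),
      hconf q₀ v₀ h₀ (fun t => (hv₀ t).trans (by norm_num)) hq₀S (by linarith)⟩
  obtain ⟨q, v, hq, hmin⟩ := ha.exists_action_minimizer hT hS.isClosed hk1.le hN hNS
    ⟨q₀, v₀, htame⟩
  have hqc : action T A Φ q v ≤ -c := by
    rw [hc, neg_neg]
    exact hmin q₀ v₀ htame
  refine ⟨q, ha.isPeriodicSolution_of_minimizer hT hS.isClosed hk1 hNS hconf hq hqc hmin hC hD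
    (le_max_right _ _) ((Real.le_coe_toNNReal _).trans (NNReal.coe_le_coe.2 (le_max_right _ _))), ?_⟩
  -- A constant loop has action `-φ(x) ≥ 0`, above the negative minimum.
  rintro ⟨x, hx⟩
  have hv : ∀ t, v t = 0 := fun t => by
    have h1 := hq.hasDerivAt t
    rw [funext hx] at h1
    exact h1.unique (hasDerivAt_const t x)
  have hxS : x ∉ S := hx 0 ▸ hNS _ (hq.mem 0)
  have h2 : action T A Φ q v = -phiMean T Φ x := by
    simp [action, lagrangian, hv, hx, phiMean]
  linarith [hφ x hxS]

theorem IsPeriodicSolution.isLoop {q : ℝ → E3} (hq : IsPeriodicSolution T S A Φ q) :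
    IsLoop T q (deriv q) where
  hasDerivAt t := (hq.contDiff.differentiable two_ne_zero t).hasDerivAt
  continuous_velocity := hq.contDiff.continuous_deriv (by norm_num)
  periodic := hq.periodic

theorem IsPeriodicSolution.norm_deriv_lt_one {q : ℝ → E3} (hq : IsPeriodicSolution T S A Φ q)
    (t : ℝ) : ‖deriv q t‖ < 1 := by
  have h : ‖deriv q t‖ₑ < 1 := (le_iSup (fun t => ‖deriv q t‖ₑ) t).trans_lt hq.speed_lt
  rwa [← ofReal_norm, ENNReal.ofReal_lt_one] at h

/-- Without singularities `∇Φ` is bounded on the whole space, so the momentum of any solution has a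
Lipschitz constant independent of the solution. Its velocity has mean zero, which bounds the
momentum itself. -/
theorem IsAdmissible.exists_speed_bound (ha : IsAdmissible T ∅ A Φ) (hT : 0 < T) :
    ∃ ρ : ℝ, 0 < ρ ∧ ρ < 1 ∧ ∀ q : ℝ → E3, IsPeriodicSolution T ∅ A Φ q →
      supNorm (deriv q) < ENNReal.ofReal ρ := by
  obtain ⟨C, hC0, hC⟩ := ha.vector.exists_bound hT
  obtain ⟨R, hR⟩ := ha.scalar.exists_far_bound one_pos
  obtain ⟨D, hD0, hD⟩ := ha.scalar.exists_gradient_bound hT isClosed_empty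
    (isCompact_closedBall (0 : E3) R) (fun x _ => notMem_empty x)
  have hgrad : ∀ t x, ‖gradient (Φ t) x‖ ≤ D + 1 := by
    intro t x
    rcases le_or_gt R ‖x‖ with hx | hx
    · linarith [hR t x hx]
    · linarith [hD t x (mem_closedBall_zero_iff.2 hx.le)]
  set B := 3 * C + (D + 1) with hB
  set k := 2 * B * T / √(1 + (2 * B * T) ^ 2) with hk
  have hk0 : 0 ≤ k := by positivity
  have hk1 : k < 1 := relVelocity_bound_lt_one _
  -- The estimate gives speed at most `k`; the midpoint between `k` and one makes the inequality
  -- strict.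
  refine ⟨(k + 1) / 2, by linarith, by linarith, fun q hq => ?_⟩
  have hloop := hq.isLoop
  have hlt := hq.norm_deriv_lt_one
  set p : ℝ → E3 := fun s => (1 / √(1 - ‖deriv q s‖ ^ 2)) • deriv q s with hp
  have hvp : ∀ t, relVelocity (p t) = deriv q t := fun t => relVelocity_momentum (hlt t)
  have hpB : ∀ s t, ‖p t - p s‖ ≤ B * |t - s| := by
    intro s t
    have := convex_univ.norm_image_sub_le_of_norm_hasDerivWithin_le (f := p) (C := B)
      (fun t _ => (hq.equation t).hasDerivWithinAt) (fun t _ => ?_) (mem_univ s) (mem_univ t)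
    · simpa using this
    · rw [magnetic, cross_curl, electric]
      have b1 := (hC t (q t)).1
      have b2 := norm_apply_le (hC t (q t)).2 (hlt t).le
      have b3 := norm_adjoint_apply_le (hC t (q t)).2 (hlt t).le
      have b4 := hgrad t (q t)
      have c1 := norm_add_le (-timeDeriv A t (q t) - gradient (Φ t) (q t))
        (ContinuousLinearMap.adjoint (fderiv ℝ (A t) (q t)) (deriv q t)
          - fderiv ℝ (A t) (q t) (deriv q t))
      have c2 := norm_sub_le (-timeDeriv A t (q t)) (gradient (Φ t) (q t))
      have c3 := norm_sub_le (ContinuousLinearMap.adjoint (fderiv ℝ (A t) (q t)) (deriv q t))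
        (fderiv ℝ (A t) (q t) (deriv q t))
      rw [norm_neg] at c2
      linarith
  have hpp : ∀ t, p (t + T) = p t := fun t => by
    simp only [hp, hloop.velocity_periodic]
  have hpbound : ∀ t, ‖p t‖ ≤ 2 * B * T := fun t => by
    -- With `W = -p` and `l = 0` the translate `l - W` is the momentum itself.
    have := norm_sub_translate_le hT (W := fun t => -p t) (l := 0)
      (fun s t => by
        rw [neg_sub_neg, norm_sub_rev]
        exact hpB s t)
      (fun t => by rw [hpp])
      (by simpa only [zero_sub, neg_neg, hvp] using hloop.integral_velocity_period) t
    simpa using this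
  have hsup : supNorm (deriv q) ≤ ENNReal.ofReal k := by
    refine iSup_le fun t => ?_
    rw [← ofReal_norm, ← hvp]
    exact ENNReal.ofReal_le_ofReal (norm_relVelocity_le (hpbound t))
  exact hsup.trans_lt ((ENNReal.ofReal_lt_ofReal_iff (by linarith)).2 (by linarith))

end Main

end LorentzForce

theorem mainTheorem2 (T : ℝ) (hT : 0 < T)
    (S : Set LorentzForce.E3) (hS : IsCompact S)
    (A : ℝ → LorentzForce.E3 → LorentzForce.E3) (Φ : ℝ → LorentzForce.E3 → ℝ)
    (hadm : LorentzForce.IsAdmissible T S A Φ)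
    (hnorm : IsLUB (LorentzForce.phiMean T Φ '' Sᶜ) 0)
    (b : ℕ → LorentzForce.E3) (hb : Tendsto (fun n => ‖b n‖) atTop atTop)
    (hosc : ∀ n, ∃ t, LorentzForce.timeDeriv A t (b n) ≠ 0)
    (hmean : Tendsto
      (fun n => LorentzForce.phiMean T Φ (b n) * (LorentzForce.oscL2 T A (b n) ^ 2)⁻¹)
      atTop (𝓝 0))
    (hgrad : Tendsto
      (fun n => LorentzForce.farGradient T S Φ (‖b n‖ - T) * (LorentzForce.oscL2 T A (b n))⁻¹)
      atTop (𝓝 0)) :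
    (∃ q : ℝ → LorentzForce.E3, LorentzForce.IsPeriodicSolution T S A Φ q ∧
      ¬ ∃ c : LorentzForce.E3, ∀ t, q t = c) ∧
    (S = ∅ → ∃ ρ : ℝ, 0 < ρ ∧ ρ < 1 ∧
      ∀ q : ℝ → LorentzForce.E3, LorentzForce.IsPeriodicSolution T S A Φ q →
        LorentzForce.supNorm (deriv q) < ENNReal.ofReal ρ) := by
  have hφ : ∀ x ∉ S, LorentzForce.phiMean T Φ x ≤ 0 := fun x hx =>
    hnorm.1 (mem_image_of_mem _ hx)
  obtain ⟨q₀, v₀, M₀, h₀, hv₀, hM₀, hq₀S, hact⟩ :=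
    hadm.exists_action_neg hT hS hb hosc hmean hgrad
  refine ⟨hadm.exists_nonconstant_solution hT hS hφ h₀ hv₀ hM₀ hq₀S hact, ?_⟩
  rintro rfl
  exact hadm.exists_speed_bound hT
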